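/- **Setting.** Let $T>0$, $d\ge 2$, $q\ge 0$. Let $(X,z,y)$ be a random triple, where $X:[0,T]\to\mathbb R^{d-1}$ is a continuous path (a random element of $C([0,T];\mathbb R^{d-1})$), $z\in\mathbb R^q$ and $y\in\{0,1\}$, such that $\operatorname{logit}P(y=1\mid X,z)=F(X)+z^\top\gamma$ with $F:C([0,T];\mathbb R^{d-1})\to\mathbb R$ continuous and $\gamma\in\mathbb R^q$. Put $\widetilde X(t)=(X(t),t)\in\mathbb R^d$; let $S_p(\widetilde X)$ be the vector of all iterated integrals $S^I(\widetilde X)=\int_{0<t_1<\dots<t_k<T}d\widetilde X^{i_1}_{t_1}\cdots d\widetilde X^{i_k}_{t_k}$ with $I\in\{1,\dots,d\}^k$, $0\le k\le p$ (so that $S^{\emptyset}=1$), let $s_d(p)=\sum_{k=0}^p d^k$ be its dimension, and $\widetilde S_p=(S_p(\widetilde X),z)\in\mathbb R^{s_d(p)+q}$. With $\ell(y,\eta)=-y\eta+\log(1+e^\eta)$, put $$\mathcal R_p(\theta)=\mathbb E\,\ell(y,\widetilde S_p^\top\theta),\qquad B_{p,r}=\{\theta\in\mathbb R^{s_d(p)+q}:\|\theta\|_1\le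 r\},\qquad L(p)=\min_{\theta\in B_{p,r}}\mathcal R_p(\theta).$$ **Assumptions.** (A.1) $\|F\|_\infty<C_F$ and $\|\gamma\|_1\le C_\gamma$ for constants $C_F,C_\gamma>0$. (A.2) Almost surely $\|X\|_{TV}<C_X$ and $\|z\|<C_z$ for constants $C_X,C_z>0$, where $\|\cdot\|$ is the Euclidean norm and $\|\cdot\|_{TV}$ the total variation with respect to it. (A.3) $r>0$, $p^*\in\mathbb N=\{0,1,2,\dots\}$ and $\theta^*_{p^*}\in B_{p^*,r}$ are such that $\mathcal R_{p^*}(\theta^*_{p^*})=\inf_{p\in\mathbb N,\ \theta\in B_{p,r}}\mathcal R_p(\theta)$, and $p^*$ is the smallest order at which this infimum is attained on $B_{p,r}$. (A.4) $\mathcal R^*\le\mathcal R_p(\theta)$ for all $p\in\mathbb N$ and all $\theta\in\mathbb R^{s_d(p)+q}$, where $\mathcal R^*$ is the infimum of $\mathbb E\,\ell(y,G(X)+z^\top g)$ over continuous $G$ with $\|G\|_\infty\le C_F$ and $g\in\mathbb R^q$ with $\|g\|_1\le C_\gamma$. **Estimator.** Let $C_{\rm pen}>0$, $\rho\in(0,\tfrac12)$.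 Given i.i.d. copies $(X_i,z_i,y_i)_{i\le n}$ of $(X,z,y)$, let $\widehat L_n(p)=\min_{\theta\in B_{p,r}}\frac1n\sum_{i=1}^n\ell\big(y_i,\widetilde S_p(\widetilde X_i,z_i)^\top\theta\big)$ and $$\widehat p=\min\Big\{\operatorname*{arg\,min}_{p\in\mathbb N}\Big(\widehat L_n(p)+\frac{C_{\rm pen}\sqrt{s_d(p)e^q}}{n^\rho}\Big)\Big\}.$$ **Claim.** Let $\widetilde{\mathcal R}^*=\mathcal R_{p^*}(\theta^*_{p^*})$, $\tilde\rho=\min(\rho,\tfrac12-\rho)$, $C=2(C_z+e^{C_X+T})$, and let $n^*$ be the smallest integer with $$(n^*)^{\tilde\rho}\ \ge\ \big(432\sqrt\pi\,rC+C_{\rm pen}\sqrt{e^q}\big)\left(\frac{2\sqrt{s_d(p^*+1)+q}}{L(p^*-1)-\widetilde{\mathcal R}^*}+\frac{\sqrt{2s_d(p^*+1)+2q}}{C_{\rm pen}\sqrt{e^q d^{p^*+1}}}\right).$$ Then for every $n\ge n^*$, $$P(\widehat p\ne p^*)\ \le\ c_1e^{-c_2n^{1-2\rho}},$$ where $$c_1=74\sum_{p>0}e^{-c_0s_d(p)}+148\,p^*,\qquad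 c_0=\frac{C_{\rm pen}^2d^{p^*+1}e^q}{256rC(36rC+1)s_d(p^*+1)},$$ $$c_2=\frac1{256rC(36rC+1)}\min\left\{\frac{C_{\rm pen}^2d^{p^*+1}e^q}{s_d(p^*+1)},\ \frac{(L(p^*-1)-\widetilde{\mathcal R}^*)^2}{4}\right\}.$$ If $p^*=0$, the two expressions that contain $L(p^*-1)$ are read with $L(-1)=+\infty$: the fraction in the threshold is $0$ and the minimum is its first entry. -/

import Mathlib

open MeasureTheory ProbabilityTheory

noncomputable section

namespace PSLR

/-! ### Paths and signatures -/

/-- Continuous functional covariates `[0, T] → ℝ^m` with the Euclidean norm on `ℝ^m`. -/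
abbrev FPath (T : ℝ) (m : ℕ) : Type :=
  C(Set.Icc (0 : ℝ) T, EuclideanSpace ℝ (Fin m))

instance instMeasurableSpaceFPath (T : ℝ) (m : ℕ) : MeasurableSpace (FPath T m) := borel _

instance instBorelSpaceFPath (T : ℝ) (m : ℕ) : BorelSpace (FPath T m) := ⟨rfl⟩

/-- `v` is the Riemann–Stieltjes integral `∫_a^b f dg`: the limit of all tagged sums as the mesh
of the partition `a = t 0 ≤ ⋯ ≤ t N = b` with tags `c k ∈ [t k, t (k+1)]` tends to `0`. -/
def IsRSIntegral (f g : ℝ → ℝ) (a b v : ℝ) : Prop :=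
  ∀ ε > 0, ∃ δ > 0, ∀ (N : ℕ) (t c : ℕ → ℝ), t 0 = a → t N = b →
    (∀ k < N, t k ≤ c k ∧ c k ≤ t (k + 1) ∧ t (k + 1) - t k < δ) →
    |∑ k ∈ Finset.range N, f (c k) * (g (t (k + 1)) - g (t k)) - v| < ε

open Classical in
/-- The Riemann–Stieltjes integral `∫_a^b f dg` (and `0` where it does not exist). -/
def rsIntegral (f g : ℝ → ℝ) (a b : ℝ) : ℝ :=
  if h : ∃ v, IsRSIntegral f g a b v then h.choose else 0

/-- The coordinates of the time-augmented path `t ↦ (X(t), t)` in `ℝ^(m+1)`; the last one is time.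
(The value outside `[0, T]` is irrelevant.) -/
def augCoord {T : ℝ} {m : ℕ} (X : FPath T m) (i : Fin (m + 1)) (t : ℝ) : ℝ :=
  Fin.lastCases (motive := fun _ => ℝ) t
    (fun j : Fin m => if h : t ∈ Set.Icc (0 : ℝ) T then X ⟨t, h⟩ j else 0) i

/-- The iterated integral `∫_{0 < t_1 < ⋯ < t_k < t} dX^{i_1}_{t_1} ⋯ dX^{i_k}_{t_k}` of the
time-augmented path, for the word `I = (i_1, …, i_k)`. -/
def iterInt {T : ℝ} {m : ℕ} (X : FPath T m) : (k : ℕ) → (Fin k → Fin (m + 1)) → ℝ → ℝ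
  | 0, _, _ => 1
  | k + 1, I, t =>
      rsIntegral (iterInt X k (Fin.init I)) (augCoord X (I (Fin.last k))) 0 t

/-- Words of length at most `p` over an alphabet of `d` letters. -/
abbrev Word (d p : ℕ) : Type := Σ k : Fin (p + 1), (Fin (k : ℕ) → Fin d)

/-- The truncated signature of order `p` of the time-augmented path. -/
def sig {T : ℝ} {m : ℕ} (p : ℕ) (X : FPath T m) (w : Word (m + 1) p) : ℝ :=
  iterInt X w.1 w.2 T

/-- The number `s_d(p) = 1 + d + ⋯ + d^p` of signature terms of order at most `p`. -/
def sDim (d p : ℕ) : ℕ := ∑ k ∈ Finset.range (p + 1), d ^ k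

/-! ### The logistic model and its risks -/

/-- Observations `(X, z, y)`. -/
abbrev Obs (T : ℝ) (m q : ℕ) : Type := FPath T m × EuclideanSpace ℝ (Fin q) × ℝ

/-- Logistic loss of the linear score `η` at the label `y`. -/
def logisticLoss (y η : ℝ) : ℝ := -y * η + Real.log (1 + Real.exp η)

/-- Coefficient vectors `θ_p = (β_p, γ)` in `ℝ^(s_d(p) + q)`, with `d = m + 1`. -/
abbrev Param (m q p : ℕ) : Type := Word (m + 1) p ⊕ Fin q → ℝ

/-- The linear score `⟨(S_p(X̃), z), θ_p⟩`. -/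
def score {T : ℝ} {m q : ℕ} (p : ℕ) (θ : Param m q p) (X : FPath T m)
    (z : EuclideanSpace ℝ (Fin q)) : ℝ :=
  ∑ w, sig p X w * θ (Sum.inl w) + ∑ j, z j * θ (Sum.inr j)

/-- The `ℓ₁`-ball `B_{p,r}`. -/
def ball (m q p : ℕ) (r : ℝ) : Set (Param m q p) := {θ | ∑ i, |θ i| ≤ r}

/-- The theoretical risk `R_p(θ_p)` under the law `ν` of `(X, z, y)`. -/
def risk {T : ℝ} {m q : ℕ} (ν : Measure (Obs T m q)) (p : ℕ) (θ : Param m q p) : ℝ :=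
  ∫ o, logisticLoss o.2.2 (score p θ o.1 o.2.1) ∂ν

/-- `L(p)`, the minimum of `R_p` over `B_{p,r}`. -/
def minRisk {T : ℝ} {m q : ℕ} (ν : Measure (Obs T m q)) (r : ℝ) (p : ℕ) : ℝ :=
  sInf (risk ν p '' ball m q p r)

/-- The empirical risk of a sample of size `n`. -/
def empRisk {T : ℝ} {m q n : ℕ} (ξ : Fin n → Obs T m q) (p : ℕ) (θ : Param m q p) : ℝ :=
  (1 / (n : ℝ)) * ∑ i, logisticLoss (ξ i).2.2 (score p θ (ξ i).1 (ξ i).2.1)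

/-- The minimum of the empirical risk over `B_{p,r}`. -/
def minEmpRisk {T : ℝ} {m q n : ℕ} (ξ : Fin n → Obs T m q) (r : ℝ) (p : ℕ) : ℝ :=
  sInf (empRisk ξ p '' ball m q p r)

/-- The penalty `C_pen √(s_d(p) e^q) / n^ρ`. -/
def pen (d q n : ℕ) (Cpen ρ : ℝ) (p : ℕ) : ℝ :=
  Cpen * Real.sqrt (sDim d p * Real.exp q) / (n : ℝ) ^ ρ

/-- The selected order: the least minimizer over `p ∈ ℕ` of the penalized empirical risk. -/
def pHat {T : ℝ} {m q n : ℕ} (r Cpen ρ : ℝ) (ξ : Fin n → Obs T m q) : ℕ :=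
  sInf {p | ∀ p' : ℕ, minEmpRisk ξ r p + pen (m + 1) q n Cpen ρ p ≤
    minEmpRisk ξ r p' + pen (m + 1) q n Cpen ρ p'}

/-! ### The semi-parametric model and the optimal order -/

/-- The semi-parametric model `logit P(y = 1 | X, z) = F(X) + ⟨z, γ⟩` with `y ∈ {0, 1}`, written
as `P(y = 1 | X, z) = sigmoid (F(X) + ⟨z, γ⟩)`. -/
def IsLogitModel {T : ℝ} {m q : ℕ} (ν : Measure (Obs T m q))
    (F : BoundedContinuousFunction (FPath T m) ℝ) (γ : Fin q → ℝ) : Prop :=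
  (∀ᵐ o ∂ν, o.2.2 = 0 ∨ o.2.2 = 1) ∧
  ν[Set.indicator {o : Obs T m q | o.2.2 = 1} (fun _ => (1 : ℝ)) |
      MeasurableSpace.comap (fun o : Obs T m q => (o.1, o.2.1)) inferInstance]
    =ᵐ[ν] fun o => Real.sigmoid (F o.1 + ∑ j, o.2.1 j * γ j)

/-- `R*`: the minimal risk of the semi-parametric model over all continuous `F` and all `γ` with
`‖F‖_∞ ≤ C_F` and `‖γ‖₁ ≤ C_γ`. -/
def semiparamRisk {T : ℝ} {m q : ℕ} (ν : Measure (Obs T m q)) (CF Cγ : ℝ) : ℝ :=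
  sInf ((fun Fγ : BoundedContinuousFunction (FPath T m) ℝ × (Fin q → ℝ) =>
      ∫ o, logisticLoss o.2.2 (Fγ.1 o.1 + ∑ j, o.2.1 j * Fγ.2 j) ∂ν) ''
    {Fγ | ‖Fγ.1‖ ≤ CF ∧ ∑ j, |Fγ.2 j| ≤ Cγ})

/-- `pstar` is the minimal sufficient truncation order and `θstar ∈ B_{pstar,r}` a corresponding
coefficient vector: `θstar` attains the least risk over all orders, and no smaller order does. -/
structure IsMinimalSufficient {T : ℝ} {m q : ℕ} (ν : Measure (Obs T m q)) (r : ℝ)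
    (pstar : ℕ) (θstar : Param m q pstar) : Prop where
  mem : θstar ∈ ball m q pstar r
  optimal : ∀ p, ∀ θ ∈ ball m q p r, risk ν pstar θstar ≤ risk ν p θ
  minimal : ∀ p, (∃ θ ∈ ball m q p r, risk ν p θ = risk ν pstar θstar) → pstar ≤ p

/-! ### The constants

`gap` stands for `L(pstar - 1) - R_{pstar}(θstar)`. If `pstar = 0` there is no order below it; this
is read as `L(-1) = +∞`, that is, the terms with `gap` are absent. -/

/-- `C = 2 (C_z + e^(C_X + T))`. -/
def lipC (CX Cz T : ℝ) : ℝ := 2 * (Cz + Real.exp (CX + T))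

/-- The right-hand side of the inequality that defines `n*`. -/
def thresholdRHS (d q pstar : ℕ) (r C Cpen gap : ℝ) : ℝ :=
  (432 * Real.sqrt Real.pi * r * C + Cpen * Real.sqrt (Real.exp q)) *
    ((if pstar = 0 then 0 else 2 * Real.sqrt (sDim d (pstar + 1) + q) / gap) +
      Real.sqrt (2 * sDim d (pstar + 1) + 2 * q) /
        (Cpen * Real.sqrt (Real.exp q * (d : ℝ) ^ (pstar + 1))))

/-- `n*`: the smallest integer `n` with `n^(min(ρ, 1/2 - ρ))` at least the threshold. -/
def nStar (d q pstar : ℕ) (r C Cpen ρ gap : ℝ) : ℕ :=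
  sInf {n : ℕ | thresholdRHS d q pstar r C Cpen gap ≤ (n : ℝ) ^ min ρ (1 / 2 - ρ)}

/-- The constant `c₀`. -/
def c0 (d q pstar : ℕ) (r C Cpen : ℝ) : ℝ :=
  Cpen ^ 2 * (d : ℝ) ^ (pstar + 1) * Real.exp q /
    (256 * r * C * (36 * r * C + 1) * sDim d (pstar + 1))

/-- The constant `c₁`; the sum is over the orders `p + 1 > 0`. -/
def c1 (d q pstar : ℕ) (r C Cpen : ℝ) : ℝ :=
  74 * ∑' p : ℕ, Real.exp (-(c0 d q pstar r C Cpen * sDim d (p + 1))) + 148 * pstar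

/-- The constant `c₂`. -/
def c2 (d q pstar : ℕ) (r C Cpen gap : ℝ) : ℝ :=
  1 / (256 * r * C * (36 * r * C + 1)) *
    (if pstar = 0 then Cpen ^ 2 * (d : ℝ) ^ (pstar + 1) * Real.exp q / sDim d (pstar + 1)
      else min (Cpen ^ 2 * (d : ℝ) ^ (pstar + 1) * Real.exp q / sDim d (pstar + 1)) (gap ^ 2 / 4))

end PSLR

end

open MeasureTheory ProbabilityTheory

namespace PSLR

/-! ### A symmetrization and contraction inequality for exponential moments of maxima -/

section Concentration

/-! If a wrong order `p` is selected, its penalized empirical risk does not exceed that of `pstar`.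
For `p > pstar` the extra penalty, and for `p < pstar` the risk gap less the penalty at `pstar`,
must then be offset by a fluctuation: the empirical risk deviates from the risk, in a known
direction, on the ball of order `p` or of order `pstar` (`exists_deviation_of_pHat_eq`). Each wrong
order therefore costs two one-sided uniform deviation bounds (`measure_pHat_eq_le`), and countable
subadditivity finishes.

The deviation bound `measure_exists_deviation_le` rests on three facts. The loss is 1-Lipschitz in
the score. Every feature is bounded by `A = C / 2`, because a signature term of level `k` is at most
`V(T)^k / k! ≤ exp V(T)` for a control `V` of the augmented path with `V(T) ≤ C_X + T`.
Symmetrization and contraction, carried out directly on exponential moments and one observation at a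
time, replace the centred loss by a randomly signed linear form in the features; on the `ℓ₁`-ball
its supremum is a maximum over single features. A Chernoff bound then gives the tail `2 (s_d(p) + q)
exp(-n x² / (32 r² A²))`.

Above `pstar`, `s_d(p) ≥ 2 s_d(pstar)` makes the penalty difference a fixed fraction of the penalty
at `p`, so the exponent is of order `n^(1-2ρ) s_d(p)`, which is summable over `p`. Below `pstar`,
the gap is positive by minimality of `pstar` and compactness of the ball. The threshold on `n` lets
half of each exponent absorb the dimension prefactor. -/

lemma exp_add_exp_le_of_le_max {a b A B : ℝ} (ha : a ≤ max A B) (hb : b ≤ max A B)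
    (hab : a + b ≤ A + B) : Real.exp a + Real.exp b ≤ Real.exp A + Real.exp B := by
  wlog hAB : B ≤ A generalizing A B with H
  · have := H (A := B) (B := A) (by rwa [max_comm]) (by rwa [max_comm]) (by linarith)
      (le_of_not_ge hAB)
    linarith
  rw [max_eq_left hAB] at ha hb
  rcases le_total b B with h | h
  · exact add_le_add (Real.exp_le_exp.2 ha) (Real.exp_le_exp.2 h)
  -- Weak majorization for an increasing convex function; in this case it comes down to `(exp A -
  -- exp b) * (1 - exp (B - b)) ≥ 0`.
  · have h1 : Real.exp a ≤ Real.exp (A + (B - b)) := Real.exp_le_exp.2 (by linarith)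
    have h2 : Real.exp B = Real.exp b * Real.exp (B - b) := by rw [← Real.exp_add]; ring_nf
    rw [Real.exp_add] at h1
    have h3 : Real.exp (B - b) ≤ 1 := by rw [Real.exp_le_one_iff]; linarith
    have h4 : Real.exp b ≤ Real.exp A := Real.exp_le_exp.2 hb
    nlinarith [mul_nonneg (sub_nonneg.2 h3) (sub_nonneg.2 h4)]

variable {ι : Type*} [Finite ι]

lemma le_iSup_of_finite (x : ι → ℝ) (t : ι) : x t ≤ ⨆ s, x s :=
  le_ciSup (Set.finite_range x).bddAbove t

variable {α : Type*} [MeasurableSpace α] (ν : Measure α)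

/-- The law of `(a, ε)` for `a` of law `ν` and an independent uniform sign `ε`. -/
noncomputable def withSign : Measure (α × ℝ) :=
  (2⁻¹ : ENNReal) • ν.map (fun a => (a, 1)) + (2⁻¹ : ENNReal) • ν.map (fun a => (a, -1))

lemma lintegral_withSign {F : α × ℝ → ENNReal} (hF : Measurable F) :
    ∫⁻ b, F b ∂withSign ν = 2⁻¹ * ∫⁻ a, F (a, 1) ∂ν + 2⁻¹ * ∫⁻ a, F (a, -1) ∂ν := by
  rw [withSign, lintegral_add_measure, lintegral_smul_measure, lintegral_smul_measure,
    lintegral_map hF (by fun_prop), lintegral_map hF (by fun_prop), smul_eq_mul, smul_eq_mul]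

variable [IsProbabilityMeasure ν]

lemma lintegral_exp_iSup_sum_succ {W : ι → α → ℝ} (hW : ∀ t, Measurable (W t)) (n : ℕ)
    (h : ι → ℝ) :
    ∫⁻ a : Fin (n + 1) → α, ENNReal.ofReal (Real.exp (⨆ t, (h t + ∑ i, W t (a i))))
        ∂Measure.pi (fun _ => ν) =
      ∫⁻ p : α × (Fin n → α), ENNReal.ofReal (Real.exp (⨆ t, (h t + (W t p.1 +
        ∑ i, W t (p.2 i))))) ∂(ν.prod (Measure.pi fun _ => ν)) := by
  rw [← (measurePreserving_piFinSuccAbove (fun _ : Fin (n + 1) => ν) 0).lintegral_comp]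
  · simp [Fin.sum_univ_succ, MeasurableEquiv.piFinSuccAbove_apply, Fin.insertNthEquiv, Fin.tail]
  · refine (Real.measurable_exp.comp (Measurable.iSup fun t => ?_)).ennreal_ofReal
    have := hW t
    fun_prop

/-- A comparison of exponential moments of maxima in one coordinate tensorizes. -/
lemma lintegral_exp_iSup_sum_le {β : Type*} [MeasurableSpace β] (ν' : Measure β)
    [IsProbabilityMeasure ν'] {X : ι → α → ℝ} {Y : ι → β → ℝ} (hX : ∀ t, Measurable (X t))
    (hY : ∀ t, Measurable (Y t))
    (hXY : ∀ h : ι → ℝ, ∫⁻ a, ENNReal.ofReal (Real.exp (⨆ t, (h t + X t a))) ∂ν ≤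
      ∫⁻ b, ENNReal.ofReal (Real.exp (⨆ t, (h t + Y t b))) ∂ν') (n : ℕ) :
    ∀ h : ι → ℝ, ∫⁻ a : Fin n → α, ENNReal.ofReal (Real.exp (⨆ t, (h t + ∑ i, X t (a i))))
        ∂Measure.pi (fun _ => ν) ≤
      ∫⁻ b : Fin n → β, ENNReal.ofReal (Real.exp (⨆ t, (h t + ∑ i, Y t (b i))))
        ∂Measure.pi (fun _ => ν') := by
  induction n with
  | zero => intro h; simp
  | succ n ih =>
    intro h
    rw [lintegral_exp_iSup_sum_succ ν hX, lintegral_exp_iSup_sum_succ ν' hY]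
    have mX : Measurable fun p : α × (Fin n → β) => ENNReal.ofReal (Real.exp (⨆ t,
        (h t + (X t p.1 + ∑ i, Y t (p.2 i))))) := by
      refine (Real.measurable_exp.comp (Measurable.iSup fun t => ?_)).ennreal_ofReal
      have := hX t; have := hY t
      fun_prop
    calc _ = ∫⁻ a, ∫⁻ a' : Fin n → α, ENNReal.ofReal (Real.exp (⨆ t, (h t + X t a +
          ∑ i, X t (a' i)))) ∂(Measure.pi fun _ => ν) ∂ν := by
          rw [lintegral_prod]
          · simp only [add_assoc]
          · refine (Real.measurable_exp.comp
              (Measurable.iSup fun t => ?_)).ennreal_ofReal.aemeasurable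
            have := hX t
            fun_prop
      -- The offset `h` is arbitrary so that it can absorb coordinates: here the one not yet
      -- exchanged, and after Fubini those already exchanged.
      _ ≤ ∫⁻ a, ∫⁻ b' : Fin n → β, ENNReal.ofReal (Real.exp (⨆ t, (h t + X t a +
          ∑ i, Y t (b' i)))) ∂(Measure.pi fun _ => ν') ∂ν := by
          exact lintegral_mono fun a => ih _
      _ = ∫⁻ b' : Fin n → β, ∫⁻ a, ENNReal.ofReal (Real.exp (⨆ t, ((h t +
          ∑ i, Y t (b' i)) + X t a))) ∂ν ∂(Measure.pi fun _ => ν') := by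
          rw [lintegral_lintegral_swap]
          · simp only [add_assoc, add_comm (X _ _)]
          · simpa only [Function.uncurry_def, add_assoc] using mX.aemeasurable
      _ ≤ ∫⁻ b' : Fin n → β, ∫⁻ b, ENNReal.ofReal (Real.exp (⨆ t, ((h t +
          ∑ i, Y t (b' i)) + Y t b))) ∂ν' ∂(Measure.pi fun _ => ν') :=
          lintegral_mono fun b' => hXY _
      _ = _ := by
          rw [lintegral_prod_symm]
          · simp only [add_assoc, add_comm (Y _ _)]
          · refine (Real.measurable_exp.comp
              (Measurable.iSup fun t => ?_)).ennreal_ofReal.aemeasurable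
            have := hY t
            fun_prop

variable [Nonempty ι]

/-- One step of the contraction principle for the exponential function. -/
lemma exp_iSup_add_exp_iSup_le (h f u : ι → ℝ) (hfu : ∀ s t, |f s - f t| ≤ |u s - u t|)
    (hf0 : ∀ t, |f t| ≤ |u t|) :
    Real.exp (⨆ t, (h t + f t)) + Real.exp (⨆ t, (h t - f t)) ≤
      Real.exp (⨆ t, (h t + u t)) + Real.exp (⨆ t, (h t - u t)) := by
  -- With `s`, `t` maximizers of the left-hand suprema, the Lipschitz bound controls the sum of the
  -- two exponents, and `hf0` controls each of them by `max A B`.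
  obtain ⟨s, hs⟩ := exists_eq_ciSup_of_finite (f := fun t => h t + f t)
  obtain ⟨t, ht⟩ := exists_eq_ciSup_of_finite (f := fun t => h t - f t)
  rw [← hs, ← ht]
  have hp := le_iSup_of_finite (fun t => h t + u t)
  have hm := le_iSup_of_finite (fun t => h t - u t)
  set A := ⨆ t, (h t + u t)
  set B := ⨆ t, (h t - u t)
  have key : ∀ t, h t + |u t| ≤ max A B := by
    intro t
    rcases abs_cases (u t) with ⟨e, _⟩ | ⟨e, _⟩ <;> rw [e]
    · exact le_max_of_le_left (hp t)
    · exact le_max_of_le_right (by have := hm t; linarith)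
  refine exp_add_exp_le_of_le_max ?_ ?_ ?_
  · have := key s; have := hf0 s; have := le_abs_self (f s); linarith
  · have := key t; have := hf0 t; have := neg_abs_le (f t); linarith
  · have h1 := (le_abs_self _).trans (hfu s t)
    have a1 := hp s; have a2 := hp t; have b1 := hm s; have b2 := hm t
    rcases abs_cases (u s - u t) with ⟨e, _⟩ | ⟨e, _⟩ <;> rw [e] at h1 <;> linarith

lemma exp_integral_le_integral_exp {g : α → ℝ} (hg : Measurable g) {K : ℝ}
    (hK : ∀ a, |g a| ≤ K) : Real.exp (∫ a, g a ∂ν) ≤ ∫ a, Real.exp (g a) ∂ν := by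
  refine ConvexOn.map_integral_le (f := g) (g := Real.exp) (s := Set.univ) convexOn_exp
    Real.continuous_exp.continuousOn isClosed_univ (by simp) ?_ ?_
  · exact Integrable.of_bound hg.aestronglyMeasurable K (Filter.Eventually.of_forall hK)
  · refine Integrable.of_bound (Real.measurable_exp.comp hg).aestronglyMeasurable (Real.exp K)
      (Filter.Eventually.of_forall fun a => ?_)
    simp only [Function.comp, Real.norm_eq_abs, Real.abs_exp]
    exact Real.exp_le_exp.2 ((le_abs_self _).trans (hK a))

/-- Symmetrization and contraction in one coordinate. -/
lemma lintegral_exp_iSup_centered_le (h : ι → ℝ) {f u : ι → α → ℝ}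
    (hf : ∀ t, Measurable (f t)) (hu : ∀ t, Measurable (u t)) {K : ℝ} (hK : ∀ t a, |f t a| ≤ K)
    (hfu : ∀ s t a, |f s a - f t a| ≤ |u s a - u t a|) (hf0 : ∀ t a, |f t a| ≤ |u t a|) :
    ∫⁻ a, ENNReal.ofReal (Real.exp (⨆ t, (h t + (f t a - ∫ b, f t b ∂ν)))) ∂ν ≤
      2⁻¹ * ∫⁻ a, ENNReal.ofReal (Real.exp (⨆ t, (h t + 2 * u t a))) ∂ν +
        2⁻¹ * ∫⁻ a, ENNReal.ofReal (Real.exp (⨆ t, (h t - 2 * u t a))) ∂ν := by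
  have mp : ∀ w : ι → α → ℝ, (∀ t, Measurable (w t)) → Measurable fun a =>
      ENNReal.ofReal (Real.exp (⨆ t, (h t + 2 * w t a))) := fun w hw =>
    (Real.measurable_exp.comp (Measurable.iSup fun t => by fun_prop)).ennreal_ofReal
  -- The centred exponent is the mean of `h + 2 f` and `h - 2 ∫ f`. Convexity of `exp` separates the
  -- two halves, at the price of the factor 2, and Jensen removes the inner expectation, so no ghost
  -- sample is needed.
  have half : ∀ x y : ℝ, ENNReal.ofReal (Real.exp (x / 2 + y / 2)) ≤
      2⁻¹ * ENNReal.ofReal (Real.exp x) + 2⁻¹ * ENNReal.ofReal (Real.exp y) := by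
    intro x y
    have : (2⁻¹ : ENNReal) = ENNReal.ofReal (2⁻¹) := by
      rw [ENNReal.ofReal_inv_of_pos two_pos]; norm_num
    rw [this, ← ENNReal.ofReal_mul (by norm_num), ← ENNReal.ofReal_mul (by norm_num),
      ← ENNReal.ofReal_add (by positivity) (by positivity)]
    refine ENNReal.ofReal_le_ofReal ?_
    have e1 : Real.exp x = Real.exp (x / 2) ^ 2 := by rw [← Real.exp_nat_mul]; ring_nf
    have e2 : Real.exp y = Real.exp (y / 2) ^ 2 := by rw [← Real.exp_nat_mul]; ring_nf
    rw [Real.exp_add, e1, e2]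
    nlinarith [sq_nonneg (Real.exp (x / 2) - Real.exp (y / 2))]
  have jensen : ENNReal.ofReal (Real.exp (⨆ t, (h t - 2 * ∫ b, f t b ∂ν))) ≤
      ∫⁻ a, ENNReal.ofReal (Real.exp (⨆ t, (h t - 2 * f t a))) ∂ν := by
    obtain ⟨t, ht⟩ := exists_eq_ciSup_of_finite (f := fun t => h t - 2 * ∫ b, f t b ∂ν)
    rw [← ht]
    have hint : Integrable (f t) ν := Integrable.of_bound (hf t).aestronglyMeasurable K
      (Filter.Eventually.of_forall (hK t))
    have e : h t - 2 * ∫ b, f t b ∂ν = ∫ b, (h t - 2 * f t b) ∂ν := by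
      rw [integral_sub (integrable_const _) (hint.const_mul 2), integral_const_mul]
      simp
    have hb : ∀ a, |h t - 2 * f t a| ≤ |h t| + 2 * K := by
      intro a
      refine (abs_sub _ _).trans ?_
      rw [abs_mul, abs_two]
      have := hK t a
      linarith
    have hmeas : Measurable fun a => h t - 2 * f t a := by fun_prop
    rw [e]
    refine (ENNReal.ofReal_le_ofReal (exp_integral_le_integral_exp ν hmeas hb)).trans ?_
    rw [ofReal_integral_eq_lintegral_ofReal]
    · exact lintegral_mono fun a => ENNReal.ofReal_le_ofReal (Real.exp_le_exp.2
        (le_iSup_of_finite (fun t => h t - 2 * f t a) t))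
    · refine Integrable.of_bound (Real.measurable_exp.comp hmeas).aestronglyMeasurable
        (Real.exp (|h t| + 2 * K)) (Filter.Eventually.of_forall fun a => ?_)
      simp only [Real.norm_eq_abs, Real.abs_exp]
      exact Real.exp_le_exp.2 ((le_abs_self _).trans (hb a))
    · exact Filter.Eventually.of_forall fun a => (Real.exp_pos _).le
  calc ∫⁻ a, ENNReal.ofReal (Real.exp (⨆ t, (h t + (f t a - ∫ b, f t b ∂ν)))) ∂ν
      ≤ ∫⁻ a, (2⁻¹ * ENNReal.ofReal (Real.exp (⨆ t, (h t + 2 * f t a))) +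
          2⁻¹ * ENNReal.ofReal (Real.exp (⨆ t, (h t - 2 * ∫ b, f t b ∂ν)))) ∂ν := by
        refine lintegral_mono fun a => le_trans (ENNReal.ofReal_le_ofReal
          (Real.exp_le_exp.2 (ciSup_le fun t => ?_))) (half _ _)
        have h1 := le_iSup_of_finite (fun t => h t + 2 * f t a) t
        have h2 := le_iSup_of_finite (fun t => h t - 2 * ∫ b, f t b ∂ν) t
        linarith
    _ ≤ 2⁻¹ * ∫⁻ a, ENNReal.ofReal (Real.exp (⨆ t, (h t + 2 * f t a))) ∂ν +
        2⁻¹ * ∫⁻ a, ENNReal.ofReal (Real.exp (⨆ t, (h t - 2 * f t a))) ∂ν := by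
        rw [lintegral_add_right _ measurable_const, lintegral_const_mul _ (mp f hf)]
        simp only [lintegral_const, measure_univ, mul_one]
        gcongr
    _ ≤ _ := by
        rw [← mul_add, ← mul_add, ← lintegral_add_left (mp f hf), ← lintegral_add_left (mp u hu)]
        refine mul_le_mul_right (lintegral_mono fun a => ?_) _
        rw [← ENNReal.ofReal_add (by positivity) (by positivity),
          ← ENNReal.ofReal_add (by positivity) (by positivity)]
        refine ENNReal.ofReal_le_ofReal (exp_iSup_add_exp_iSup_le h (fun t => 2 * f t a)
          (fun t => 2 * u t a) (fun s t => ?_) (fun t => ?_))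
        · simp only [← mul_sub, abs_mul, abs_two]
          have := hfu s t a
          linarith
        · simp only [abs_mul, abs_two]
          have := hf0 t a
          linarith

instance : IsProbabilityMeasure (withSign ν) := by
  constructor
  rw [← lintegral_one, lintegral_withSign ν measurable_const]
  simp [ENNReal.inv_two_add_inv_two]

/-- Averaging over one sign gives `cosh (v a) ≤ exp (B² / 2)`. Tensorization over a one-point index
set, with a constant process on the right, multiplies these factors. -/
lemma lintegral_exp_sum_sign_le {v : α → ℝ} (hv : Measurable v) {B : ℝ}
    (hB : ∀ a, |v a| ≤ B) (n : ℕ) :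
    ∫⁻ b : Fin n → α × ℝ, ENNReal.ofReal (Real.exp (∑ i, (b i).2 * v (b i).1))
        ∂Measure.pi (fun _ => withSign ν) ≤ ENNReal.ofReal (Real.exp (n * (B ^ 2 / 2))) := by
  have key := lintegral_exp_iSup_sum_le (ι := Unit) (withSign ν) (withSign ν)
    (X := fun _ b => b.2 * v b.1) (Y := fun _ _ => B ^ 2 / 2) (fun _ => by fun_prop)
    (fun _ => by fun_prop) (fun h => ?_) n (fun _ => 0)
  · simpa using key
  · simp only [ciSup_unique, PUnit.default_eq_unit, lintegral_const, measure_univ, mul_one]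
    rw [lintegral_withSign ν (by fun_prop), ← mul_add, ← lintegral_add_left (by fun_prop)]
    have hpt : ∀ a, ENNReal.ofReal (Real.exp (h () + 1 * v a)) +
        ENNReal.ofReal (Real.exp (h () + -1 * v a)) ≤
        2 * ENNReal.ofReal (Real.exp (h () + B ^ 2 / 2)) := by
      intro a
      have h2 : (2 : ENNReal) = ENNReal.ofReal 2 := by simp
      rw [← ENNReal.ofReal_add (by positivity) (by positivity), h2,
        ← ENNReal.ofReal_mul (by norm_num)]
      refine ENNReal.ofReal_le_ofReal ?_
      have h1 := Real.cosh_le_exp_half_sq (v a)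
      have h3 : Real.exp (v a ^ 2 / 2) ≤ Real.exp (B ^ 2 / 2) := by
        refine Real.exp_le_exp.2 ?_
        have := sq_le_sq' (by linarith [neg_abs_le (v a), hB a])
          ((le_abs_self _).trans (hB a))
        linarith
      rw [Real.cosh_eq] at h1
      rw [Real.exp_add, Real.exp_add, Real.exp_add, one_mul, neg_one_mul]
      nlinarith [Real.exp_pos (h ())]
    calc _ ≤ (2⁻¹ : ENNReal) * ∫⁻ _, 2 * ENNReal.ofReal (Real.exp (h () + B ^ 2 / 2)) ∂ν := by
          gcongr with a
          exact hpt a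
      _ = _ := by
          rw [lintegral_const, measure_univ, mul_one, ← mul_assoc,
            ENNReal.inv_mul_cancel (by simp) (by simp), one_mul]

/-- Exponential moments of the maximum of a centred empirical process that is dominated by a
family of linear forms with coefficients in an `ℓ₁`-ball. -/
lemma lintegral_exp_iSup_empirical_le {J : Type*} [Fintype J] [Nonempty J] {f : ι → α → ℝ}
    {v : J → α → ℝ} {c : ι → J → ℝ} {R A : ℝ} (hf : ∀ t, Measurable (f t))
    (hv : ∀ j, Measurable (v j)) (hvA : ∀ j a, |v j a| ≤ A) (hc : ∀ t, ∑ j, |c t j| ≤ R)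
    (hfu : ∀ s t a, |f s a - f t a| ≤ |∑ j, c s j * v j a - ∑ j, c t j * v j a|)
    (hf0 : ∀ t a, |f t a| ≤ |∑ j, c t j * v j a|) (n : ℕ) :
    ∫⁻ a : Fin n → α, ENNReal.ofReal (Real.exp (⨆ t, ∑ i, (f t (a i) - ∫ b, f t b ∂ν)))
        ∂Measure.pi (fun _ => ν) ≤
      ENNReal.ofReal (2 * Fintype.card J * Real.exp (n * (2 * R ^ 2 * A ^ 2))) := by
  have hR : 0 ≤ R := (Finset.sum_nonneg fun j _ => abs_nonneg _).trans (hc (Classical.arbitrary ι))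
  obtain ⟨a₀⟩ : Nonempty α := nonempty_of_isProbabilityMeasure ν
  have hA : 0 ≤ A := (abs_nonneg _).trans (hvA (Classical.arbitrary J) a₀)
  have lin : ∀ t (w : J → ℝ) (B : ℝ), (∀ j, |w j| ≤ B) → |∑ j, c t j * w j| ≤ R * B := by
    intro t w B hw
    have hB : 0 ≤ B := (abs_nonneg _).trans (hw (Classical.arbitrary J))
    calc |∑ j, c t j * w j| ≤ ∑ j, |c t j| * B :=
          (Finset.abs_sum_le_sum_abs _ _).trans (Finset.sum_le_sum fun j _ => by
            rw [abs_mul]; exact mul_le_mul_of_nonneg_left (hw j) (abs_nonneg _))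
      _ ≤ R * B := by rw [← Finset.sum_mul]; exact mul_le_mul_of_nonneg_right (hc t) hB
  have comp := lintegral_exp_iSup_sum_le ν (withSign ν) (X := fun t a => f t a - ∫ b, f t b ∂ν)
    (Y := fun t b => b.2 * (2 * ∑ j, c t j * v j b.1)) (fun t => by have := hf t; fun_prop)
    (fun t => by fun_prop) (fun h => ?_) n (fun _ => 0)
  · simp only [zero_add] at comp
    refine comp.trans ?_
    -- Duality of `ℓ₁` and `ℓ_∞`: the supremum is at most `2 R max_j |w j|`, and the exponential of
    -- a maximum is at most the sum over `j` and both signs. Hence the factor `2 * card J`; the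
    -- number of indices `t` does not enter.
    have hpt : ∀ b : Fin n → α × ℝ,
        ENNReal.ofReal (Real.exp (⨆ t, ∑ i, (b i).2 * (2 * ∑ j, c t j * v j (b i).1))) ≤
        ∑ j, (ENNReal.ofReal (Real.exp (∑ i, (b i).2 * ((2 * R) * v j (b i).1))) +
          ENNReal.ofReal (Real.exp (∑ i, (b i).2 * ((-2 * R) * v j (b i).1)))) := by
      intro b
      set w : J → ℝ := fun j => ∑ i, (b i).2 * v j (b i).1 with hw
      have e1 : ∀ t, ∑ i, (b i).2 * (2 * ∑ j, c t j * v j (b i).1) = 2 * ∑ j, c t j * w j := by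
        intro t
        simp only [hw, Finset.mul_sum]
        rw [Finset.sum_comm]
        refine Finset.sum_congr rfl fun j _ => Finset.sum_congr rfl fun i _ => by ring
      have e2 : ∀ (κ : ℝ) j, ∑ i, (b i).2 * (κ * v j (b i).1) = κ * w j := by
        intro κ j
        simp only [hw, Finset.mul_sum]
        exact Finset.sum_congr rfl fun i _ => by ring
      simp only [e1, e2]
      obtain ⟨j, hj⟩ := exists_eq_ciSup_of_finite (f := fun j => |w j|)
      have hle : (⨆ t, 2 * ∑ j, c t j * w j) ≤ 2 * R * |w j| := ciSup_le fun t => by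
        have := (le_abs_self _).trans (lin t w _ fun j' =>
          (le_iSup_of_finite (fun j => |w j|) j').trans_eq hj.symm)
        linarith
      refine le_trans ?_ (Finset.single_le_sum (fun _ _ => zero_le) (Finset.mem_univ j))
      rcases abs_cases (w j) with ⟨e, _⟩ | ⟨e, _⟩ <;> rw [e] at hle
      · exact le_add_right (ENNReal.ofReal_le_ofReal (Real.exp_le_exp.2 hle))
      · exact le_add_left (ENNReal.ofReal_le_ofReal (Real.exp_le_exp.2 (by linarith)))
    have hexp : ∀ (κ : ℝ) j, |κ| = 2 * R → ∫⁻ b : Fin n → α × ℝ,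
        ENNReal.ofReal (Real.exp (∑ i, (b i).2 * (κ * v j (b i).1)))
          ∂Measure.pi (fun _ => withSign ν) ≤
        ENNReal.ofReal (Real.exp (n * (2 * R ^ 2 * A ^ 2))) := by
      intro κ j hκ
      refine (lintegral_exp_sum_sign_le ν (v := fun a => κ * v j a) (by fun_prop)
        (B := 2 * R * A) (fun a => ?_) n).trans_eq ?_
      · rw [abs_mul, hκ]
        exact mul_le_mul_of_nonneg_left (hvA j a) (by linarith)
      · congr 2; ring
    calc _ ≤ ∑ j, (∫⁻ b : Fin n → α × ℝ,
          ENNReal.ofReal (Real.exp (∑ i, (b i).2 * ((2 * R) * v j (b i).1)))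
            ∂Measure.pi (fun _ => withSign ν) +
          ∫⁻ b : Fin n → α × ℝ,
          ENNReal.ofReal (Real.exp (∑ i, (b i).2 * ((-2 * R) * v j (b i).1)))
            ∂Measure.pi (fun _ => withSign ν)) := by
          refine (lintegral_mono hpt).trans_eq ?_
          rw [lintegral_finsetSum _ (fun j _ => by fun_prop)]
          exact Finset.sum_congr rfl fun j _ => lintegral_add_left (by fun_prop) _
      _ ≤ ∑ _j : J, (ENNReal.ofReal (Real.exp (n * (2 * R ^ 2 * A ^ 2))) +
          ENNReal.ofReal (Real.exp (n * (2 * R ^ 2 * A ^ 2)))) := by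
          refine Finset.sum_le_sum fun j _ => add_le_add (hexp _ j ?_) (hexp _ j ?_)
          · rw [abs_of_nonneg (by linarith)]
          · rw [abs_of_nonpos (by linarith)]; ring
      _ = _ := by
          rw [Finset.sum_const, ← ENNReal.ofReal_add (by positivity) (by positivity),
            nsmul_eq_mul, Finset.card_univ, ← ENNReal.ofReal_natCast,
            ← ENNReal.ofReal_mul (by positivity)]
          congr 1; ring
  · refine (lintegral_exp_iSup_centered_le ν h (u := fun t a => ∑ j, c t j * v j a) hf
      (fun t => by fun_prop) (K := R * A) (fun t a => (hf0 t a).trans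
        (lin t _ _ fun j => hvA j a)) hfu hf0).trans_eq ?_
    rw [lintegral_withSign ν]
    · simp [sub_eq_add_neg]
    · exact (Real.measurable_exp.comp (Measurable.iSup fun t => by fun_prop)).ennreal_ofReal

/-- Tail bound for the maximum of a centred empirical process that is dominated by a family of
linear forms with coefficients in an `ℓ₁`-ball. -/
lemma measure_exists_le_sum_centered_le {J : Type*} [Fintype J] [Nonempty J] {f : ι → α → ℝ}
    {v : J → α → ℝ} {c : ι → J → ℝ} {R A : ℝ} (hR : 0 < R) (hA : 0 < A)
    (hf : ∀ t, Measurable (f t))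
    (hv : ∀ j, Measurable (v j)) (hvA : ∀ j a, |v j a| ≤ A) (hc : ∀ t, ∑ j, |c t j| ≤ R)
    (hfu : ∀ s t a, |f s a - f t a| ≤ |∑ j, c s j * v j a - ∑ j, c t j * v j a|)
    (hf0 : ∀ t a, |f t a| ≤ |∑ j, c t j * v j a|) (n : ℕ) {x : ℝ} (hx : 0 < x) :
    Measure.pi (fun _ : Fin n => ν)
        {a | ∃ t, n * x ≤ ∑ i, (f t (a i) - ∫ b, f t b ∂ν)} ≤
      ENNReal.ofReal (2 * Fintype.card J * Real.exp (-(n * x ^ 2 / (8 * R ^ 2 * A ^ 2)))) := by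
  -- The minimizer of the Chernoff exponent `2 l² R² A² - l x`.
  set l : ℝ := x / (4 * R ^ 2 * A ^ 2) with hl
  have hl0 : 0 < l := by positivity
  have hint : ∀ t, ∫ b, l * f t b ∂ν = l * ∫ b, f t b ∂ν := fun t => integral_const_mul _ _
  have key := lintegral_exp_iSup_empirical_le ν (f := fun t a => l * f t a) (v := v)
    (c := fun t j => l * c t j) (R := l * R) (A := A) (fun t => by have := hf t; fun_prop) hv hvA
    (fun t => by
      simp only [abs_mul, abs_of_pos hl0, ← Finset.mul_sum]
      exact mul_le_mul_of_nonneg_left (hc t) hl0.le)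
    (fun s t a => by
      simp only [mul_assoc, ← Finset.mul_sum, ← mul_sub, abs_mul, abs_of_pos hl0]
      exact mul_le_mul_of_nonneg_left (hfu s t a) hl0.le)
    (fun t a => by
      simp only [mul_assoc, ← Finset.mul_sum, abs_mul, abs_of_pos hl0]
      exact mul_le_mul_of_nonneg_left (hf0 t a) hl0.le) n
  simp only [hint] at key
  set Φ : (Fin n → α) → ENNReal := fun a => ENNReal.ofReal
    (Real.exp (⨆ t, ∑ i, (l * f t (a i) - l * ∫ b, f t b ∂ν))) with hΦ
  have hsub : {a : Fin n → α | ∃ t, n * x ≤ ∑ i, (f t (a i) - ∫ b, f t b ∂ν)} ⊆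
      {a | ENNReal.ofReal (Real.exp (l * (n * x))) ≤ Φ a} := by
    rintro a ⟨t, ht⟩
    refine ENNReal.ofReal_le_ofReal (Real.exp_le_exp.2 ?_)
    refine le_trans ?_ (le_iSup_of_finite _ t)
    simp only [← mul_sub, ← Finset.mul_sum]
    exact mul_le_mul_of_nonneg_left ht hl0.le
  have hΦm : Measurable Φ :=
    (Real.measurable_exp.comp (Measurable.iSup fun t => by have := hf t; fun_prop)).ennreal_ofReal
  have markov := mul_meas_ge_le_lintegral₀ (μ := Measure.pi fun _ : Fin n => ν)
    hΦm.aemeasurable (ENNReal.ofReal (Real.exp (l * (n * x))))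
  have hpos : ENNReal.ofReal (Real.exp (l * (n * x))) ≠ 0 := by
    simp [Real.exp_pos]
  refine (measure_mono hsub).trans ?_
  have h1 := markov.trans key
  rw [mul_comm, ← ENNReal.le_div_iff_mul_le (Or.inl hpos) (Or.inl ENNReal.ofReal_ne_top),
    ← ENNReal.ofReal_div_of_pos (Real.exp_pos _)] at h1
  refine h1.trans_eq ?_
  rw [mul_div_assoc, ← Real.exp_sub]
  congr 3
  rw [hl]
  field_simp
  ring

end Concentration

/-! ### Riemann–Stieltjes integrals -/

section RiemannStieltjes

open Set Filter Topology

lemma partition_mem_Icc {t : ℕ → ℝ} {N : ℕ} {a b : ℝ} (h0 : t 0 = a) (hN : t N = b)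
    (ht : ∀ k < N, t k ≤ t (k + 1)) {k : ℕ} (hk : k ≤ N) : t k ∈ Icc a b := by
  have hm : Monotone fun k => t (min k N) := monotone_nat_of_le_succ fun k => by
    rcases lt_or_ge k N with h | h
    · rw [min_eq_left h.le, min_eq_left h]; exact ht k h
    · rw [min_eq_right h, min_eq_right (h.trans k.le_succ)]
  have h1 := hm (Nat.zero_le k)
  have h2 := hm hk
  simp only [Nat.zero_min, min_eq_left hk, min_self] at h1 h2
  exact ⟨h0 ▸ h1, hN ▸ h2⟩

lemma IsRSIntegral.congr {f f' g g' : ℝ → ℝ} {a b v : ℝ} (h : IsRSIntegral f g a b v)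
    (hf : EqOn f f' (Icc a b)) (hg : EqOn g g' (Icc a b)) : IsRSIntegral f' g' a b v := by
  intro ε hε
  obtain ⟨δ, hδ, H⟩ := h ε hε
  refine ⟨δ, hδ, fun N t c h0 hN ht => ?_⟩
  have hmem : ∀ k ≤ N, t k ∈ Icc a b := fun k hk =>
    partition_mem_Icc h0 hN (fun k hk => (ht k hk).1.trans (ht k hk).2.1) hk
  convert H N t c h0 hN ht using 4 with k hk
  rw [Finset.mem_range] at hk
  rw [hf ⟨(hmem k hk.le).1.trans (ht k hk).1, (ht k hk).2.1.trans (hmem (k + 1) hk).2⟩,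
    hg (hmem k hk.le), hg (hmem (k + 1) hk)]

/-- Serves the decomposition `g = ((V + g) - (V - g)) / 2` into monotone integrators. -/
lemma IsRSIntegral.half_sub {f g₁ g₂ : ℝ → ℝ} {a b v₁ v₂ : ℝ} (h₁ : IsRSIntegral f g₁ a b v₁)
    (h₂ : IsRSIntegral f g₂ a b v₂) :
    IsRSIntegral f (fun t => (g₁ t - g₂ t) / 2) a b ((v₁ - v₂) / 2) := by
  intro ε hε
  obtain ⟨δ₁, hδ₁, H₁⟩ := h₁ ε hε
  obtain ⟨δ₂, hδ₂, H₂⟩ := h₂ ε hε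
  refine ⟨min δ₁ δ₂, lt_min hδ₁ hδ₂, fun N t c h0 hN ht => ?_⟩
  have e₁ := H₁ N t c h0 hN fun k hk =>
    ⟨(ht k hk).1, (ht k hk).2.1, (ht k hk).2.2.trans_le (min_le_left _ _)⟩
  have e₂ := H₂ N t c h0 hN fun k hk =>
    ⟨(ht k hk).1, (ht k hk).2.1, (ht k hk).2.2.trans_le (min_le_right _ _)⟩
  have : ∑ k ∈ Finset.range N, f (c k) * ((g₁ (t (k + 1)) - g₂ (t (k + 1))) / 2 -
      (g₁ (t k) - g₂ (t k)) / 2) =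
      (∑ k ∈ Finset.range N, f (c k) * (g₁ (t (k + 1)) - g₁ (t k)) -
        ∑ k ∈ Finset.range N, f (c k) * (g₂ (t (k + 1)) - g₂ (t k))) / 2 := by
    rw [← Finset.sum_sub_distrib, Finset.sum_div]
    exact Finset.sum_congr rfl fun k _ => by ring
  rw [this]
  rw [abs_lt] at e₁ e₂ ⊢
  constructor <;> linarith

/-- By uniform continuity of `f`, the error on each cell is a small multiple of the `G`-mass of the
cell, and these masses telescope. The `+ 1` in the denominator covers constant `G`. -/
lemma isRSIntegral_stieltjes (G : StieltjesFunction ℝ) {f : ℝ → ℝ} {a b : ℝ} (hab : a ≤ b)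
    (hf : ContinuousOn f (Icc a b)) :
    IsRSIntegral f G a b (∫ x in a..b, f x ∂G.measure) := by
  intro ε hε
  have hK : 0 ≤ G b - G a := sub_nonneg.2 (G.mono hab)
  have hε' : 0 < ε / (G b - G a + 1) := by positivity
  obtain ⟨δ, hδ, H⟩ := Metric.uniformContinuousOn_iff.1
    (isCompact_Icc.uniformContinuousOn_of_continuous hf) _ hε'
  refine ⟨δ, hδ, fun N t c h0 hN ht => ?_⟩
  have hle : ∀ k < N, t k ≤ t (k + 1) := fun k hk => (ht k hk).1.trans (ht k hk).2.1
  have hmem : ∀ k ≤ N, t k ∈ Icc a b := fun k hk => partition_mem_Icc h0 hN hle hk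
  have hii : ∀ k < N, IntervalIntegrable f G.measure (t k) (t (k + 1)) := fun k hk =>
    (hf.mono (by
      rw [uIcc_of_le (hle k hk)]
      exact Icc_subset_Icc (hmem k hk.le).1 (hmem (k + 1) hk).2)).intervalIntegrable
  rw [← h0, ← hN, ← intervalIntegral.sum_integral_adjacent_intervals hii,
    ← Finset.sum_sub_distrib]
  have hterm : ∀ k ∈ Finset.range N, |f (c k) * (G (t (k + 1)) - G (t k)) -
      ∫ x in t k..t (k + 1), f x ∂G.measure| ≤
      ε / (G b - G a + 1) * (G (t (k + 1)) - G (t k)) := by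
    intro k hk
    rw [Finset.mem_range] at hk
    have hG : 0 ≤ G (t (k + 1)) - G (t k) := sub_nonneg.2 (G.mono (hle k hk))
    have hreal : G.measure.real (Ioc (t k) (t (k + 1))) = G (t (k + 1)) - G (t k) := by
      rw [Measure.real, G.measure_Ioc, ENNReal.toReal_ofReal hG]
    have hconst : f (c k) * (G (t (k + 1)) - G (t k)) =
        ∫ x in t k..t (k + 1), f (c k) ∂G.measure := by
      rw [intervalIntegral.integral_of_le (hle k hk), setIntegral_const, hreal, smul_eq_mul,
        mul_comm]
    have hic : IntervalIntegrable (fun _ => f (c k)) G.measure (t k) (t (k + 1)) :=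
      continuous_const.intervalIntegrable _ _
    rw [hconst, ← intervalIntegral.integral_sub hic (hii k hk),
      intervalIntegral.integral_of_le (hle k hk), ← hreal, ← Real.norm_eq_abs]
    refine norm_setIntegral_le_of_norm_le_const (by rw [G.measure_Ioc]; exact ENNReal.ofReal_lt_top)
      fun x hx => ?_
    have := H (c k) ⟨(hmem k hk.le).1.trans (ht k hk).1, (ht k hk).2.1.trans (hmem (k + 1) hk).2⟩
      x ⟨(hmem k hk.le).1.trans hx.1.le, hx.2.trans (hmem (k + 1) hk).2⟩ ?_
    · rw [Real.dist_eq] at this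
      exact this.le
    · rw [Real.dist_eq, abs_lt]
      have := ht k hk
      constructor <;> linarith [hx.1, hx.2]
  calc _ ≤ ∑ k ∈ Finset.range N, ε / (G b - G a + 1) * (G (t (k + 1)) - G (t k)) :=
        (Finset.abs_sum_le_sum_abs _ _).trans (Finset.sum_le_sum hterm)
    _ = ε / (G b - G a + 1) * (G b - G a) := by
        rw [← Finset.mul_sum, Finset.sum_range_sub (fun k => G (t k)), h0, hN]
    _ < ε := by
        rw [div_mul_eq_mul_div, div_lt_iff₀ (by positivity)]
        nlinarith

/-- Left Riemann–Stieltjes sum on the uniform partition of `[0, b]` into `N + 1` intervals. -/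
noncomputable def leftSum (f g : ℝ → ℝ) (b : ℝ) (N : ℕ) : ℝ :=
  ∑ k ∈ Finset.range (N + 1), f (k * (b / (N + 1))) *
    (g ((k + 1 : ℕ) * (b / (N + 1))) - g (k * (b / (N + 1))))

/-- One explicit sequence of partitions, the same for every path, yields uniqueness of the integral,
transfer of bounds to the limit, and measurability in the path. -/
lemma IsRSIntegral.tendsto_leftSum {f g : ℝ → ℝ} {b v : ℝ} (hb : 0 ≤ b)
    (h : IsRSIntegral f g 0 b v) : Tendsto (leftSum f g b) atTop (𝓝 v) := by
  rw [Metric.tendsto_atTop]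
  intro ε hε
  obtain ⟨δ, hδ, H⟩ := h ε hε
  obtain ⟨M, hM⟩ := exists_nat_gt (b / δ)
  refine ⟨M, fun N hN => ?_⟩
  rw [Real.dist_eq]
  have hN1 : (0 : ℝ) < N + 1 := by positivity
  have hs : 0 ≤ b / (N + 1) := by positivity
  refine H (N + 1) (fun k => k * (b / (N + 1))) (fun k => k * (b / (N + 1))) (by simp)
    (by push_cast; field_simp) fun k _ => ⟨le_rfl, ?_, ?_⟩
  · push_cast; nlinarith
  · have : b / (N + 1) < δ := by
      rw [div_lt_iff₀ hN1]
      rw [div_lt_iff₀ hδ] at hM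
      have : (M : ℝ) ≤ N := by exact_mod_cast hN
      nlinarith
    push_cast
    linarith

lemma IsRSIntegral.rsIntegral_eq {f g : ℝ → ℝ} {b v : ℝ} (hb : 0 ≤ b)
    (h : IsRSIntegral f g 0 b v) : rsIntegral f g 0 b = v := by
  have hex : ∃ v, IsRSIntegral f g 0 b v := ⟨v, h⟩
  rw [rsIntegral, dif_pos hex]
  exact tendsto_nhds_unique (hex.choose_spec.tendsto_leftSum hb) (h.tendsto_leftSum hb)

variable {V g : ℝ → ℝ}

lemma continuous_of_dominated (hV : Continuous V)
    (hg : ∀ s t, s ≤ t → |g t - g s| ≤ V t - V s) : Continuous g := by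
  rw [continuous_iff_continuousAt]
  intro x
  rw [ContinuousAt, tendsto_iff_dist_tendsto_zero]
  have h0 : Tendsto (fun t => dist (V t) (V x)) (𝓝 x) (𝓝 0) :=
    tendsto_iff_dist_tendsto_zero.1 hV.continuousAt
  refine squeeze_zero (fun _ => dist_nonneg) (fun t => ?_) h0
  rw [Real.dist_eq, Real.dist_eq]
  rcases le_total x t with h | h
  · exact (hg x t h).trans (le_abs_self _)
  · rw [abs_sub_comm, abs_sub_comm (V t)]
    exact (hg t x h).trans (le_abs_self _)

/-- The Riemann–Stieltjes integral of a continuous function against a function whose increments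
are dominated by those of a continuous function. -/
lemma exists_isRSIntegral_of_dominated (hV : Continuous V)
    (hg : ∀ s t, s ≤ t → |g t - g s| ≤ V t - V s) {f : ℝ → ℝ} {b M : ℝ}
    (hf : ContinuousOn f (Icc 0 b)) (hM : ∀ t ∈ Icc 0 b, |f t| ≤ M) :
    ∃ I : ℝ → ℝ, (∀ t ∈ Icc 0 b, IsRSIntegral f g 0 t (I t)) ∧
      ∀ s ∈ Icc 0 b, ∀ t ∈ Icc 0 b, s ≤ t → |I t - I s| ≤ M * (V t - V s) := by
  have hgc := continuous_of_dominated hV hg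
  -- Domination of the increments of `g` by those of `V` is exactly monotonicity of `V + g` and `V -
  -- g`. Their mean is `V`, whence the increment bound for `I`.
  let P : StieltjesFunction ℝ :=
    { toFun := fun t => V t + g t
      mono' := fun s t h => by have := (abs_le.1 (hg s t h)).1; simp only; linarith
      right_continuous' := fun x => (hV.add hgc).continuousWithinAt }
  let Q : StieltjesFunction ℝ :=
    { toFun := fun t => V t - g t
      mono' := fun s t h => by have := (abs_le.1 (hg s t h)).2; simp only; linarith
      right_continuous' := fun x => (hV.sub hgc).continuousWithinAt }
  refine ⟨fun t => ((∫ x in 0..t, f x ∂P.measure) - ∫ x in 0..t, f x ∂Q.measure) / 2, ?_, ?_⟩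
  · intro t ht
    have hft : ContinuousOn f (Icc 0 t) := hf.mono (Icc_subset_Icc_right ht.2)
    refine ((isRSIntegral_stieltjes P ht.1 hft).half_sub
      (isRSIntegral_stieltjes Q ht.1 hft)).congr (fun _ _ => rfl) fun x _ => ?_
    change (V x + g x - (V x - g x)) / 2 = g x
    ring
  · intro s hs t ht hst
    have hii : ∀ G : StieltjesFunction ℝ, ∀ x ∈ Icc 0 b, ∀ y ∈ Icc 0 b,
        IntervalIntegrable f G.measure x y := fun G x hx y hy =>
      (hf.mono (uIcc_subset_Icc hx hy)).intervalIntegrable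
    have hb0 : (0 : ℝ) ∈ Icc 0 b := ⟨le_rfl, hs.1.trans hs.2⟩
    have hbound : ∀ G : StieltjesFunction ℝ,
        |(∫ x in 0..t, f x ∂G.measure) - ∫ x in 0..s, f x ∂G.measure| ≤ M * (G t - G s) := by
      intro G
      rw [intervalIntegral.integral_interval_sub_left (hii G 0 hb0 t ht) (hii G 0 hb0 s hs),
        intervalIntegral.integral_of_le hst, ← Real.norm_eq_abs]
      have hreal : G.measure.real (Ioc s t) = G t - G s := by
        rw [Measure.real, G.measure_Ioc, ENNReal.toReal_ofReal (sub_nonneg.2 (G.mono hst))]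
      rw [← hreal]
      exact norm_setIntegral_le_of_norm_le_const (by rw [G.measure_Ioc]; exact ENNReal.ofReal_lt_top)
        fun x hx => hM x ⟨hs.1.trans hx.1.le, hx.2.trans ht.2⟩
    have h1 := hbound P
    have h2 := hbound Q
    have e1 : P t - P s = V t - V s + (g t - g s) := by
      change V t + g t - (V s + g s) = _; ring
    have e2 : Q t - Q s = V t - V s - (g t - g s) := by
      change V t - g t - (V s - g s) = _; ring
    rw [e1] at h1
    rw [e2] at h2
    rw [abs_le] at h1 h2 ⊢
    constructor <;> nlinarith [h1.1, h1.2, h2.1, h2.2]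

/-- A left-endpoint lower bound for `∫_x^y u^k / k! du`, stated without the integral. -/
lemma pow_div_factorial_mul_sub_le {x y : ℝ} (hx : 0 ≤ x) (hxy : x ≤ y) (k : ℕ) :
    x ^ k / k.factorial * (y - x) ≤
      y ^ (k + 1) / (k + 1).factorial - x ^ (k + 1) / (k + 1).factorial := by
  have hb : x ^ k * (y - x) * (k + 1) ≤ y ^ (k + 1) - x ^ (k + 1) := by
    induction k with
    | zero => simp
    | succ k ih =>
      have h1 : x ^ (k + 1) ≤ y ^ (k + 1) := pow_le_pow_left₀ hx hxy _
      have h2 := mul_le_mul_of_nonneg_left ih hx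
      push_cast
      have h3 := mul_nonneg (sub_nonneg.2 hxy) (sub_nonneg.2 h1)
      calc x ^ (k + 1) * (y - x) * (k + 1 + 1)
          = x * (x ^ k * (y - x) * (k + 1)) + x ^ (k + 1) * (y - x) := by ring
        _ ≤ x * (y ^ (k + 1) - x ^ (k + 1)) + y ^ (k + 1) * (y - x) := by
            have := mul_le_mul_of_nonneg_right h1 (sub_nonneg.2 hxy)
            linarith
        _ = _ := by ring
  have hfac : ((k + 1).factorial : ℝ) = (k + 1) * k.factorial := by
    rw [Nat.factorial_succ]; push_cast; ring
  have hk : (0 : ℝ) < k.factorial := by positivity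
  rw [← sub_div, le_div_iff₀ (by positivity), hfac]
  calc x ^ k / k.factorial * (y - x) * ((k + 1) * k.factorial)
      = x ^ k * (y - x) * (k + 1) := by field_simp
    _ ≤ _ := hb

/-- Left tags matter: each term of the left sum is bounded through `V` at the left endpoint, hence
by an increment of `V^(k+1) / (k+1)!`, and the increments telescope. -/
lemma IsRSIntegral.abs_le_pow_div_factorial (hV : Monotone V) (hV0 : V 0 = 0)
    (hg : ∀ s t, s ≤ t → |g t - g s| ≤ V t - V s) {f : ℝ → ℝ} {b v : ℝ} (hb : 0 ≤ b) {k : ℕ}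
    (hf : ∀ t ∈ Icc 0 b, |f t| ≤ V t ^ k / k.factorial) (h : IsRSIntegral f g 0 b v) :
    |v| ≤ V b ^ (k + 1) / (k + 1).factorial := by
  refine le_of_tendsto (h.tendsto_leftSum hb).abs (Eventually.of_forall fun N => ?_)
  have hs : 0 ≤ b / (N + 1) := by positivity
  set p : ℕ → ℝ := fun k => k * (b / (N + 1)) with hp
  have hpm : Monotone p := fun i j hij => by
    simp only [hp]
    have : (i : ℝ) ≤ j := by exact_mod_cast hij
    gcongr
  have hp0 : p 0 = 0 := by simp [hp]
  have hpN : p (N + 1) = b := by simp only [hp]; push_cast; field_simp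
  calc |leftSum f g b N| ≤ ∑ i ∈ Finset.range (N + 1),
        (V (p (i + 1)) ^ (k + 1) / (k + 1).factorial - V (p i) ^ (k + 1) / (k + 1).factorial) := by
        refine (Finset.abs_sum_le_sum_abs _ _).trans (Finset.sum_le_sum fun i hi => ?_)
        have hi' : i ≤ N + 1 := (Finset.mem_range.1 hi).le
        have hpi : p i ∈ Icc 0 b := ⟨hp0 ▸ hpm (Nat.zero_le i), hpN ▸ hpm hi'⟩
        have hV' : 0 ≤ V (p i) := hV0 ▸ hV hpi.1
        rw [abs_mul]
        refine le_trans ?_ (pow_div_factorial_mul_sub_le hV' (hV (hpm i.le_succ)) k)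
        exact mul_le_mul (hf _ hpi) (hg _ _ (hpm i.le_succ)) (abs_nonneg _)
          (by positivity)
    _ = _ := by
        rw [Finset.sum_range_sub (fun i => V (p i) ^ (k + 1) / (k + 1).factorial), hpN, hp0, hV0]
        simp

end RiemannStieltjes

/-! ### Signatures of paths of bounded variation -/

section Signature

open Set Filter Topology

variable {T : ℝ} {m : ℕ}

lemma augCoord_castSucc (X : FPath T m) (j : Fin m) {t : ℝ} (ht : t ∈ Icc (0 : ℝ) T) :
    augCoord X j.castSucc t = X ⟨t, ht⟩ j := by
  simp [augCoord, ht]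

lemma augCoord_last (X : FPath T m) (t : ℝ) : augCoord X (Fin.last m) t = t := by
  simp [augCoord]

/-- A control of the increments of the time-augmented path. -/
lemma exists_control (hT : 0 < T) {CX : ℝ} (hCX : 0 < CX) (X : FPath T m)
    (hX : eVariationOn (fun t => X t) univ < ENNReal.ofReal CX) :
    ∃ (V : ℝ → ℝ) (g : Fin (m + 1) → ℝ → ℝ), Monotone V ∧ Continuous V ∧ V 0 = 0 ∧
      V T ≤ CX + T ∧ (∀ i, EqOn (g i) (augCoord X i) (Icc 0 T)) ∧
      ∀ i s t, s ≤ t → |g i t - g i s| ≤ V t - V s := by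
  set x : ℝ → EuclideanSpace ℝ (Fin m) := IccExtend hT.le X with hx
  have hxc : Continuous x := X.continuous.Icc_extend'
  have hle : eVariationOn x univ ≤ eVariationOn (fun t => X t) univ :=
    eVariationOn.comp_le_of_monotoneOn (fun t => X t) (projIcc 0 T hT.le)
      ((monotone_projIcc hT.le).monotoneOn _) (mapsTo_univ _ _)
  have hbv : BoundedVariationOn x univ := (hle.trans_lt (hX.trans ENNReal.ofReal_lt_top)).ne
  have hlbv := hbv.locallyBoundedVariationOn
  set W : ℝ → ℝ := variationOnFromTo x univ 0 with hW
  have hWm : Monotone W := monotoneOn_univ.1 (variationOnFromTo.monotoneOn hlbv (mem_univ _))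
  have hWc : Continuous W := by
    rw [continuous_iff_continuousAt]
    intro y
    rw [continuousAt_iff_continuous_left_right]
    refine ⟨?_, hbv.continuousWithinAt_variationOnFromTo_Ici hxc.continuousWithinAt⟩
    rw [← continuousWithinAt_Iio_iff_Iic]
    have := variationOnFromTo.tendsto_left (f := x) (l := x y) (mem_univ (0 : ℝ)) (mem_univ y)
      hlbv (hxc.continuousWithinAt)
    simpa [ContinuousWithinAt] using this
  have hWd : ∀ s t, s ≤ t → dist (x t) (x s) ≤ W t - W s := by
    intro s t hst
    rw [hW, variationOnFromTo.sub_right hlbv (mem_univ _) (mem_univ _) (mem_univ _),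
      variationOnFromTo.eq_of_le _ _ hst, dist_edist]
    refine ENNReal.toReal_mono (hlbv s t (mem_univ _) (mem_univ _)) ?_
    exact eVariationOn.edist_le _ ⟨mem_univ _, hst, le_rfl⟩ ⟨mem_univ _, le_rfl, hst⟩
  -- `W` controls the spatial coordinates and `t` the time coordinate; the path is extended by
  -- constants outside `[0, T]`.
  refine ⟨fun t => W t + t, Fin.lastCases (fun t => t) fun j t => x t j, ?_, ?_, ?_, ?_, ?_, ?_⟩
  · exact hWm.add monotone_id
  · exact hWc.add continuous_id
  · simp [hW, variationOnFromTo.self]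
  · simp only [add_le_add_iff_right]
    rw [hW, variationOnFromTo.eq_of_le _ _ hT.le]
    refine ENNReal.toReal_le_of_le_ofReal hCX.le ?_
    exact (eVariationOn.mono _ (subset_univ _)).trans (hle.trans hX.le)
  · intro i
    induction i using Fin.lastCases with
    | last => intro t _; simp [augCoord_last]
    | cast j =>
      intro t ht
      simp [augCoord_castSucc X j ht, hx, IccExtend_of_mem hT.le _ ht]
  · intro i s t hst
    have h1 := hWm hst
    induction i using Fin.lastCases with
    | last =>
      simp only [Fin.lastCases_last]
      rw [abs_of_nonneg (sub_nonneg.2 hst)]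
      linarith
    | cast j =>
      simp only [Fin.lastCases_castSucc]
      have h2 : |x t j - x s j| ≤ dist (x t) (x s) := by
        rw [dist_eq_norm, ← Real.norm_eq_abs]
        exact PiLp.norm_apply_le (x t - x s) j
      have := hWd s t hst
      linarith

/-- Iterated integrals of a controlled path exist as limits of Riemann–Stieltjes sums, are
continuous, and satisfy the factorial bound. -/
lemma iterInt_controlled (X : FPath T m) {V : ℝ → ℝ} {g : Fin (m + 1) → ℝ → ℝ}
    (hVm : Monotone V) (hVc : Continuous V) (hV0 : V 0 = 0)
    (hgX : ∀ i, EqOn (g i) (augCoord X i) (Icc 0 T))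
    (hg : ∀ i s t, s ≤ t → |g i t - g i s| ≤ V t - V s) :
    ∀ (k : ℕ) (I : Fin k → Fin (m + 1)), ContinuousOn (iterInt X k I) (Icc 0 T) ∧
      ∀ t ∈ Icc 0 T, |iterInt X k I t| ≤ V t ^ k / k.factorial := by
  intro k
  induction k with
  | zero => intro I; exact ⟨continuousOn_const, fun t _ => by simp [iterInt]⟩
  | succ k ih =>
    intro I
    obtain ⟨hc, hb⟩ := ih (Fin.init I)
    -- Continuity and the factorial bound must be proved together: continuity at level `k` makes the
    -- integral at level `k + 1` exist, and boundedness makes that integral continuous.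
    set M := V T ^ k / k.factorial with hM
    have hbM : ∀ t ∈ Icc 0 T, |iterInt X k (Fin.init I) t| ≤ M := fun t ht => by
      refine (hb t ht).trans ?_
      have h0 : 0 ≤ V t := hV0 ▸ hVm ht.1
      have h1 : V t ≤ V T := hVm ht.2
      rw [hM]
      gcongr
    obtain ⟨J, hJ, hJd⟩ := exists_isRSIntegral_of_dominated hVc (hg (I (Fin.last k))) hc hbM
    have heq : ∀ t ∈ Icc 0 T, iterInt X (k + 1) I t = J t := fun t ht => by
      rw [iterInt]
      exact ((hJ t ht).congr (fun _ _ => rfl)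
        ((hgX _).mono (Icc_subset_Icc_right ht.2))).rsIntegral_eq ht.1
    constructor
    · refine ContinuousOn.congr ?_ heq
      intro x hx
      rw [ContinuousWithinAt, tendsto_iff_dist_tendsto_zero]
      have h0 : Tendsto (fun t => M * dist (V t) (V x)) (𝓝[Icc 0 T] x) (𝓝 0) := by
        have := (tendsto_iff_dist_tendsto_zero.1
          (hVc.continuousAt (x := x))).mono_left (nhdsWithin_le_nhds (s := Icc 0 T))
        simpa using this.const_mul M
      refine squeeze_zero' (Eventually.of_forall fun _ => dist_nonneg) ?_ h0
      filter_upwards [self_mem_nhdsWithin] with t ht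
      have hM0 : 0 ≤ M := (abs_nonneg _).trans (hbM x hx)
      rw [Real.dist_eq, Real.dist_eq]
      rcases le_total x t with h | h
      · exact (hJd x hx t ht h).trans (mul_le_mul_of_nonneg_left (le_abs_self _) hM0)
      · rw [abs_sub_comm, abs_sub_comm (V t)]
        exact (hJd t ht x hx h).trans (mul_le_mul_of_nonneg_left (le_abs_self _) hM0)
    · intro t ht
      rw [heq t ht]
      exact (hJ t ht).abs_le_pow_div_factorial hVm hV0 (hg _) ht.1
        fun s hs => hb s ⟨hs.1, hs.2.trans ht.2⟩

lemma tendsto_leftSum_iterInt (hT : 0 < T) {CX : ℝ} (hCX : 0 < CX) (X : FPath T m)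
    (hX : eVariationOn (fun t => X t) univ < ENNReal.ofReal CX) (k : ℕ)
    (I : Fin (k + 1) → Fin (m + 1)) {t : ℝ} (ht : t ∈ Icc 0 T) :
    Tendsto (leftSum (iterInt X k (Fin.init I)) (augCoord X (I (Fin.last k))) t) atTop
      (𝓝 (iterInt X (k + 1) I t)) := by
  obtain ⟨V, g, hVm, hVc, hV0, -, hgX, hg⟩ := exists_control hT hCX X hX
  obtain ⟨hc, hb⟩ := iterInt_controlled X hVm hVc hV0 hgX hg k (Fin.init I)
  obtain ⟨M, hM⟩ := isCompact_Icc.exists_bound_of_continuousOn hc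
  obtain ⟨J, hJ, -⟩ := exists_isRSIntegral_of_dominated hVc (hg (I (Fin.last k))) hc hM
  have h := (hJ t ht).congr (fun _ _ => rfl) ((hgX _).mono (Icc_subset_Icc_right ht.2))
  rw [iterInt, h.rsIntegral_eq ht.1]
  exact h.tendsto_leftSum ht.1

/-- One term of the exponential series at `V T ≤ CX + T` bounds every level, so the bound does not
depend on `p`. -/
lemma abs_sig_le (hT : 0 < T) {CX : ℝ} (hCX : 0 < CX) (X : FPath T m)
    (hX : eVariationOn (fun t => X t) univ < ENNReal.ofReal CX) (p : ℕ) (w : Word (m + 1) p) :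
    |sig p X w| ≤ Real.exp (CX + T) := by
  obtain ⟨V, g, hVm, hVc, hV0, hVT, hgX, hg⟩ := exists_control hT hCX X hX
  refine ((iterInt_controlled X hVm hVc hV0 hgX hg w.1 w.2).2 T ⟨hT.le, le_rfl⟩).trans ?_
  have h0 : 0 ≤ V T := hV0 ▸ hVm hT.le
  exact (Real.pow_div_factorial_le_exp _ h0 _).trans (Real.exp_le_exp.2 hVT)

lemma measurable_augCoord (i : Fin (m + 1)) (t : ℝ) :
    Measurable fun X : FPath T m => augCoord X i t := by
  induction i using Fin.lastCases with
  | last => simp only [augCoord_last]; exact measurable_const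
  | cast j =>
    by_cases ht : t ∈ Icc (0 : ℝ) T
    · simp only [augCoord_castSucc _ j ht]
      refine Continuous.measurable ?_
      have : Continuous fun X : FPath T m => X ⟨t, ht⟩ := continuous_eval_const _
      fun_prop
    · simp [augCoord, ht]

/-- `rsIntegral` is defined by choice, so measurability is obtained from almost sure limits of left
sums. These evaluate the lower level at grid points, which is why `t` is quantified inside the
induction. -/
lemma aemeasurable_iterInt (hT : 0 < T) {CX : ℝ} (hCX : 0 < CX) {α : Type*} [MeasurableSpace α]
    {ν : Measure α} {X : α → FPath T m} (hXm : Measurable X)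
    (hX : ∀ᵐ a ∂ν, eVariationOn (fun t => X a t) univ < ENNReal.ofReal CX) :
    ∀ (k : ℕ) (I : Fin k → Fin (m + 1)), ∀ t ∈ Icc 0 T,
      AEMeasurable (fun a => iterInt (X a) k I t) ν := by
  intro k
  induction k with
  | zero => intro I t _; simp only [iterInt]; exact aemeasurable_const
  | succ k ih =>
    intro I t ht
    refine aemeasurable_of_tendsto_metrizable_ae atTop (f := fun N a =>
      leftSum (iterInt (X a) k (Fin.init I)) (augCoord (X a) (I (Fin.last k))) t N) ?_ ?_
    · intro N
      refine Finset.aemeasurable_fun_sum _ fun j hj => ?_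
      have hjN : (j : ℝ) ≤ N + 1 := by exact_mod_cast (Finset.mem_range.1 hj).le
      have ht0 := ht.1
      have hmem : (j : ℝ) * (t / (N + 1)) ∈ Icc 0 T := by
        refine ⟨by positivity, le_trans ?_ ht.2⟩
        rw [mul_div_assoc', div_le_iff₀ (by positivity)]
        nlinarith
      refine (ih _ _ hmem).mul (AEMeasurable.sub ?_ ?_)
      · exact ((measurable_augCoord _ _).comp hXm).aemeasurable
      · exact ((measurable_augCoord _ _).comp hXm).aemeasurable
    · filter_upwards [hX] with a ha
      exact tendsto_leftSum_iterInt hT hCX (X a) ha k I ht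

end Signature

/-! ### The logistic loss -/

section Loss

lemma logisticLoss_zero (y : ℝ) : logisticLoss y 0 = Real.log 2 := by
  norm_num [logisticLoss]

lemma logisticLoss_nonneg {y : ℝ} (h0 : 0 ≤ y) (h1 : y ≤ 1) (η : ℝ) : 0 ≤ logisticLoss y η := by
  have he := Real.exp_pos η
  have a : 0 ≤ Real.log (1 + Real.exp η) := Real.log_nonneg (by linarith)
  have b : η ≤ Real.log (1 + Real.exp η) := by
    rw [Real.le_log_iff_exp_le (by positivity)]; linarith
  rw [logisticLoss]
  nlinarith [mul_nonneg h0 (sub_nonneg.2 b), mul_nonneg (sub_nonneg.2 h1) a]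

/-- Increments of `log (1 + exp η)` lie between `0` and the increment of `η`; subtracting `y ∈ [0,
1]` times the latter keeps the modulus at most that increment. -/
lemma abs_logisticLoss_sub_le {y : ℝ} (h0 : 0 ≤ y) (h1 : y ≤ 1) (η η' : ℝ) :
    |logisticLoss y η - logisticLoss y η'| ≤ |η - η'| := by
  wlog h : η' ≤ η generalizing η η' with H
  · rw [abs_sub_comm, abs_sub_comm η]
    exact H η' η (le_of_not_ge h)
  have a : Real.log (1 + Real.exp η') ≤ Real.log (1 + Real.exp η) :=
    Real.log_le_log (by positivity) (by have := Real.exp_le_exp.2 h; linarith)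
  have b : Real.log (1 + Real.exp η) ≤ (η - η') + Real.log (1 + Real.exp η') := by
    rw [← Real.log_exp (η - η'), ← Real.log_mul (by positivity) (by positivity)]
    refine Real.log_le_log (by positivity) ?_
    rw [mul_add, ← Real.exp_add, sub_add_cancel, mul_one]
    have := Real.one_le_exp (sub_nonneg.2 h)
    linarith
  have hη := sub_nonneg.2 h
  rw [logisticLoss, logisticLoss, abs_of_nonneg hη, abs_le]
  constructor <;> nlinarith [mul_nonneg h0 hη, mul_nonneg (sub_nonneg.2 h1) hη]

@[fun_prop]
lemma continuous_logisticLoss : Continuous fun p : ℝ × ℝ => logisticLoss p.1 p.2 := by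
  unfold logisticLoss
  refine (continuous_fst.neg.mul continuous_snd).add (Continuous.log (by fun_prop) fun p => ?_)
  positivity

end Loss

/-! ### Risks -/

section Risk

variable {T : ℝ} {m q : ℕ}

/-- The coordinates of `(S_p(X̃), z)`. -/
noncomputable def feature (p : ℕ) (i : Word (m + 1) p ⊕ Fin q) (o : Obs T m q) : ℝ :=
  Sum.elim (fun w => sig p o.1 w) (fun j => o.2.1 j) i

lemma score_eq_sum_feature (p : ℕ) (θ : Param m q p) (o : Obs T m q) :
    score p θ o.1 o.2.1 = ∑ i, θ i * feature p i o := by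
  simp [score, feature, Fintype.sum_sum_type, mul_comm]

instance (p : ℕ) : Nonempty (Word (m + 1) p ⊕ Fin q) :=
  ⟨Sum.inl ⟨0, fun i => i.elim0⟩⟩

/-- Labels in `[0, 1]` and features bounded by `A`. -/
structure IsBoundedObs (A : ℝ) (o : Obs T m q) : Prop where
  label_nonneg : 0 ≤ o.2.2
  label_le_one : o.2.2 ≤ 1
  abs_feature_le : ∀ p i, |feature p i o| ≤ A

lemma abs_sum_mul_le {J : Type*} [Fintype J] {A : ℝ} (c v : J → ℝ) (hv : ∀ j, |v j| ≤ A) :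
    |∑ j, c j * v j| ≤ A * ∑ j, |c j| := by
  rw [Finset.mul_sum]
  refine (Finset.abs_sum_le_sum_abs _ _).trans (Finset.sum_le_sum fun j _ => ?_)
  rw [abs_mul, mul_comm]
  exact mul_le_mul_of_nonneg_right (hv j) (abs_nonneg _)

lemma IsBoundedObs.abs_loss_sub_le {A : ℝ} {o : Obs T m q} (ho : IsBoundedObs A o) {p : ℕ}
    (θ θ' : Param m q p) :
    |logisticLoss o.2.2 (score p θ o.1 o.2.1) - logisticLoss o.2.2 (score p θ' o.1 o.2.1)| ≤
      A * ∑ i, |θ i - θ' i| := by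
  refine (abs_logisticLoss_sub_le ho.label_nonneg ho.label_le_one _ _).trans ?_
  rw [score_eq_sum_feature, score_eq_sum_feature, ← Finset.sum_sub_distrib]
  simp only [← sub_mul]
  exact abs_sum_mul_le _ _ (ho.abs_feature_le p)

lemma zero_mem_ball (p : ℕ) {r : ℝ} (hr : 0 ≤ r) : (0 : Param m q p) ∈ ball m q p r := by
  simpa [ball] using hr

lemma isCompact_ball (p : ℕ) (r : ℝ) : IsCompact (ball m q p r) := by
  refine Metric.isCompact_of_isClosed_isBounded ?_ ?_
  · exact isClosed_le (by fun_prop) continuous_const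
  · refine (Metric.isBounded_closedBall (x := (0 : Param m q p)) (r := r)).subset fun θ hθ => ?_
    rw [mem_closedBall_zero_iff]
    have h0 : 0 ≤ r := (Finset.sum_nonneg fun i _ => abs_nonneg _).trans hθ
    refine (pi_norm_le_iff_of_nonneg h0).2 fun i => ?_
    exact (Finset.single_le_sum (f := fun i => |θ i|) (fun _ _ => abs_nonneg _)
      (Finset.mem_univ i)).trans hθ

/-- Finite nets of the `ℓ₁`-ball for the `ℓ₁`-distance. -/
lemma exists_finite_net (p : ℕ) (r : ℝ) {ε : ℝ} (hε : 0 < ε) :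
    ∃ D : Set (Param m q p), D ⊆ ball m q p r ∧ D.Finite ∧
      ∀ θ ∈ ball m q p r, ∃ θ' ∈ D, ∑ i, |θ i - θ' i| ≤ ε := by
  obtain ⟨N, hN⟩ : ∃ N : ℝ, N = (Fintype.card (Word (m + 1) p ⊕ Fin q) : ℝ) := ⟨_, rfl⟩
  have hNpos : 0 < N := by rw [hN]; exact_mod_cast Fintype.card_pos
  obtain ⟨D, hD, hfin, hcov⟩ := (isCompact_ball (m := m) (q := q) p r).finite_cover_balls
    (div_pos hε hNpos)
  refine ⟨D, hD, hfin, fun θ hθ => ?_⟩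
  obtain ⟨θ', hθ', hd⟩ := Set.mem_iUnion₂.1 (hcov hθ)
  refine ⟨θ', hθ', ?_⟩
  rw [Metric.mem_ball] at hd
  calc ∑ i, |θ i - θ' i| ≤ ∑ _i : Word (m + 1) p ⊕ Fin q, ε / N :=
        Finset.sum_le_sum fun i _ => by
          rw [← Real.dist_eq]; exact (dist_le_pi_dist θ θ' i).trans hd.le
    _ = ε := by
        rw [Finset.sum_const, Finset.card_univ, nsmul_eq_mul, ← hN]
        field_simp

variable {ν : Measure (Obs T m q)} {A : ℝ}

lemma ae_isBoundedObs (hT : 0 < T) {CX Cz : ℝ} (hCX : 0 < CX)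
    (hy : ∀ᵐ o ∂ν, o.2.2 = 0 ∨ o.2.2 = 1)
    (hX : ∀ᵐ o ∂ν, eVariationOn (fun t => o.1 t) Set.univ < ENNReal.ofReal CX)
    (hz : ∀ᵐ o ∂ν, ‖o.2.1‖ < Cz) : ∀ᵐ o ∂ν, IsBoundedObs (Cz + Real.exp (CX + T)) o := by
  filter_upwards [hy, hX, hz] with o hy hX hz
  have hz0 : 0 < Cz := (norm_nonneg _).trans_lt hz
  refine ⟨?_, ?_, fun p i => ?_⟩
  · rcases hy with h | h <;> rw [h]; exact zero_le_one
  · rcases hy with h | h <;> rw [h]; exact zero_le_one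
  · rcases i with w | j
    · exact (abs_sig_le hT hCX o.1 hX p w).trans (by linarith)
    · have h1 : |o.2.1 j| ≤ ‖o.2.1‖ := PiLp.norm_apply_le o.2.1 j
      have := Real.exp_pos (CX + T)
      exact h1.trans (by linarith)

lemma aemeasurable_feature (hT : 0 < T) {CX : ℝ} (hCX : 0 < CX)
    (hX : ∀ᵐ o ∂ν, eVariationOn (fun t => o.1 t) Set.univ < ENNReal.ofReal CX) (p : ℕ)
    (i : Word (m + 1) p ⊕ Fin q) : AEMeasurable (feature (T := T) p i) ν := by
  rcases i with w | j
  · exact aemeasurable_iterInt hT hCX measurable_fst hX w.1 w.2 T ⟨hT.le, le_rfl⟩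
  · refine Measurable.aemeasurable ?_
    change Measurable fun o : Obs T m q => o.2.1 j
    fun_prop

variable [IsProbabilityMeasure ν]

lemma integrable_loss (hm : ∀ p i, AEMeasurable (feature (T := T) p i) ν)
    (hA : ∀ᵐ o ∂ν, IsBoundedObs A o) (p : ℕ) (θ : Param m q p) :
    Integrable (fun o : Obs T m q => logisticLoss o.2.2 (score p θ o.1 o.2.1)) ν := by
  have hs : AEMeasurable (fun o : Obs T m q => score p θ o.1 o.2.1) ν := by
    simp only [score_eq_sum_feature]
    exact Finset.aemeasurable_fun_sum _ fun i _ => (hm p i).const_mul _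
  have hmeas : AEMeasurable
      (fun o : Obs T m q => logisticLoss o.2.2 (score p θ o.1 o.2.1)) ν :=
    continuous_logisticLoss.measurable.comp_aemeasurable
      ((measurable_snd.comp measurable_snd).aemeasurable.prodMk hs)
  refine Integrable.of_bound hmeas.aestronglyMeasurable
    (Real.log 2 + A * ∑ i, |θ i|) ?_
  filter_upwards [hA] with o ho
  have h := ho.abs_loss_sub_le θ 0
  have h0 : score p (0 : Param m q p) o.1 o.2.1 = 0 := by simp [score]
  rw [h0, logisticLoss_zero] at h
  simp only [Pi.zero_apply, sub_zero] at h
  rw [Real.norm_eq_abs, abs_of_nonneg (logisticLoss_nonneg ho.label_nonneg ho.label_le_one _)]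
  linarith [le_abs_self (logisticLoss o.2.2 (score p θ o.1 o.2.1) - Real.log 2)]

lemma abs_risk_sub_le (hm : ∀ p i, AEMeasurable (feature (T := T) p i) ν)
    (hA : ∀ᵐ o ∂ν, IsBoundedObs A o) (p : ℕ) (θ θ' : Param m q p) :
    |risk ν p θ - risk ν p θ'| ≤ A * ∑ i, |θ i - θ' i| := by
  rw [risk, risk, ← integral_sub (integrable_loss hm hA p θ) (integrable_loss hm hA p θ'),
    ← Real.norm_eq_abs]
  refine (norm_integral_le_of_norm_le_const (C := A * ∑ i, |θ i - θ' i|) ?_).trans_eq (by simp)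
  filter_upwards [hA] with o ho
  exact ho.abs_loss_sub_le θ θ'

lemma continuous_risk (hm : ∀ p i, AEMeasurable (feature (T := T) p i) ν)
    (hA : ∀ᵐ o ∂ν, IsBoundedObs A o) (p : ℕ) : Continuous (risk ν p) := by
  rw [continuous_iff_continuousAt]
  intro θ
  rw [ContinuousAt, tendsto_iff_dist_tendsto_zero]
  have h0 : Filter.Tendsto (fun θ' : Param m q p => A * ∑ i, |θ' i - θ i|) (nhds θ) (nhds 0) := by
    have : Continuous fun θ' : Param m q p => A * ∑ i, |θ' i - θ i| := by fun_prop
    simpa using this.tendsto θ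
  exact squeeze_zero (fun _ => dist_nonneg) (fun θ' => abs_risk_sub_le hm hA p θ' θ) h0

lemma abs_empRisk_sub_le {n : ℕ} (hn : 0 < n) {ξ : Fin n → Obs T m q}
    (hξ : ∀ i, IsBoundedObs A (ξ i)) (p : ℕ) (θ θ' : Param m q p) :
    |empRisk ξ p θ - empRisk ξ p θ'| ≤ A * ∑ i, |θ i - θ' i| := by
  have hn' : (0 : ℝ) < n := by exact_mod_cast hn
  rw [empRisk, empRisk, ← mul_sub, ← Finset.sum_sub_distrib, abs_mul,
    abs_of_pos (by positivity), one_div_mul_eq_div, div_le_iff₀ hn']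
  calc _ ≤ ∑ _i : Fin n, A * ∑ i, |θ i - θ' i| :=
        (Finset.abs_sum_le_sum_abs _ _).trans
          (Finset.sum_le_sum fun i _ => (hξ i).abs_loss_sub_le θ θ')
    _ = _ := by simp [mul_comm]

lemma empRisk_nonneg {n : ℕ} {ξ : Fin n → Obs T m q} (hξ : ∀ i, IsBoundedObs A (ξ i)) (p : ℕ)
    (θ : Param m q p) : 0 ≤ empRisk ξ p θ :=
  mul_nonneg (by positivity) (Finset.sum_nonneg fun i _ =>
    logisticLoss_nonneg (hξ i).label_nonneg (hξ i).label_le_one _)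

/-- Uniform deviation of the empirical risk from the risk, in the direction `σ = ±1`. -/
lemma measure_exists_deviation_le (hm : ∀ p i, AEMeasurable (feature (T := T) p i) ν)
    (hA : ∀ᵐ o ∂ν, IsBoundedObs A o) (hA0 : 0 < A) {r : ℝ} (hr : 0 < r) {n : ℕ} (hn : 0 < n)
    {Ω : Type*} [MeasurableSpace Ω] {μ : Measure Ω} [IsProbabilityMeasure μ]
    {ξ : Fin n → Ω → Obs T m q} (hlaw : ∀ i, HasLaw (ξ i) ν μ) (hindep : iIndepFun ξ μ) (p : ℕ)
    {x : ℝ} (hx : 0 < x) {σ : ℝ} (hσ : |σ| = 1) :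
    μ {ω | ∃ θ ∈ ball m q p r, x ≤ σ * (empRisk (fun i => ξ i ω) p θ - risk ν p θ)} ≤
      ENNReal.ofReal (2 * Fintype.card (Word (m + 1) p ⊕ Fin q) *
        Real.exp (-(n * x ^ 2 / (32 * r ^ 2 * A ^ 2)))) := by
  have hn' : (0 : ℝ) < n := by exact_mod_cast hn
  -- The mesh `x / (4 A)` costs `x / 4` in the empirical risk and `x / 4` in the risk, leaving a
  -- deviation `x / 2` on the net. Its cardinality is irrelevant to the tail bound.
  obtain ⟨D, hD, hfin, hnet⟩ := exists_finite_net (m := m) (q := q) p r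
    (ε := x / (4 * A)) (by positivity)
  have : Finite D := hfin
  have : Nonempty D := by
    obtain ⟨θ', hθ', -⟩ := hnet 0 (zero_mem_ball p hr.le)
    exact ⟨⟨θ', hθ'⟩⟩
  -- everywhere bounded versions of the features and the label
  set v : (Word (m + 1) p ⊕ Fin q) → Obs T m q → ℝ :=
    fun i o => max (-A) (min A ((hm p i).mk _ o)) with hv
  set y' : Obs T m q → ℝ := fun o => max 0 (min 1 o.2.2) with hy'
  have hvm : ∀ i, Measurable (v i) := fun i => by
    have := (hm p i).measurable_mk
    fun_prop
  have hym : Measurable y' := by fun_prop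
  have hy0 : ∀ o, 0 ≤ y' o := fun o => le_max_left _ _
  have hy1 : ∀ o, y' o ≤ 1 := fun o => max_le zero_le_one (min_le_left _ _)
  have hvA : ∀ i o, |v i o| ≤ A := fun i o =>
    abs_le.2 ⟨le_max_left _ _, max_le (by linarith) (min_le_left _ _)⟩
  set u : D → Obs T m q → ℝ := fun θ o => ∑ i, θ.1 i * v i o with hu
  have hum : ∀ θ, Measurable (u θ) := fun θ => by fun_prop
  -- Subtracting `log 2`, the loss at score `0`, gives `|f| ≤ |u|` as contraction requires; the
  -- constant cancels in the centring.
  set f : D → Obs T m q → ℝ := fun θ o => σ * (logisticLoss (y' o) (u θ o) - Real.log 2) with hf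
  have hfm : ∀ θ, Measurable (f θ) := fun θ =>
    ((continuous_logisticLoss.measurable.comp (hym.prodMk (hum θ))).sub_const _).const_mul _
  have tail := measure_exists_le_sum_centered_le ν (f := f) (v := v) (c := fun θ => θ.1) hr hA0
    hfm hvm hvA (fun θ => hD θ.2)
    (fun s t o => by
      simp only [hf]
      rw [← mul_sub, abs_mul, hσ, one_mul, sub_sub_sub_cancel_right]
      exact abs_logisticLoss_sub_le (hy0 o) (hy1 o) _ _)
    (fun t o => by
      simp only [hf]
      rw [abs_mul, hσ, one_mul, ← logisticLoss_zero (y' o)]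
      refine (abs_logisticLoss_sub_le (hy0 o) (hy1 o) _ _).trans_eq ?_
      rw [sub_zero]) n (half_pos hx)
  -- the two versions agree almost everywhere
  have hgood : ∀ᵐ o ∂ν, IsBoundedObs A o ∧
      ∀ θ : D, f θ o = σ * (logisticLoss o.2.2 (score p θ.1 o.1 o.2.1) - Real.log 2) := by
    filter_upwards [hA, ae_all_iff.2 fun i => (hm p i).ae_eq_mk] with o ho hmk
    refine ⟨ho, fun θ => ?_⟩
    have e1 : y' o = o.2.2 := by
      simp only [hy', min_eq_right ho.label_le_one, max_eq_right ho.label_nonneg]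
    have e2 : u θ o = score p θ.1 o.1 o.2.1 := by
      rw [score_eq_sum_feature]
      refine Finset.sum_congr rfl fun i _ => ?_
      have := abs_le.1 (ho.abs_feature_le p i)
      simp only [hv]
      rw [← hmk i, min_eq_right this.2, max_eq_right this.1]
    simp only [hf, e1, e2]
  have hfint : ∀ θ : D, ∫ o, f θ o ∂ν = σ * (risk ν p θ.1 - Real.log 2) := by
    intro θ
    rw [integral_congr_ae (hgood.mono fun o ho => ho.2 θ), integral_const_mul,
      integral_sub (integrable_loss hm hA p θ.1) (integrable_const _)]
    simp [risk]
  have hsample : ∀ᵐ ω ∂μ, ∀ i, IsBoundedObs A (ξ i ω) ∧ ∀ θ : D, f θ (ξ i ω) =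
      σ * (logisticLoss (ξ i ω).2.2 (score p θ.1 (ξ i ω).1 (ξ i ω).2.1) - Real.log 2) :=
    ae_all_iff.2 fun i => ae_of_ae_map (hlaw i).aemeasurable ((hlaw i).map_eq.symm ▸ hgood)
  have hmap : μ.map (fun ω i => ξ i ω) = Measure.pi fun _ : Fin n => ν := by
    rw [(iIndepFun_iff_map_fun_eq_pi_map fun i => (hlaw i).aemeasurable).1 hindep]
    simp only [(hlaw _).map_eq]
  have hjoint : AEMeasurable (fun ω i => ξ i ω) μ :=
    aemeasurable_pi_lambda _ fun i => (hlaw i).aemeasurable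
  -- This inequality holds for arbitrary sets, so the deviation event need not be measurable.
  have hle := (Measure.le_map_apply hjoint _).trans (hmap ▸ tail)
  refine le_trans (measure_mono_ae ?_) (hle.trans_eq ?_)
  · filter_upwards [hsample] with ω hω
    rintro ⟨θ, hθ, hxθ⟩
    obtain ⟨θ', hθ', hd⟩ := hnet θ hθ
    refine ⟨⟨θ', hθ'⟩, ?_⟩
    have hd' : A * ∑ i, |θ i - θ' i| ≤ x / 4 := by
      calc _ ≤ A * (x / (4 * A)) := mul_le_mul_of_nonneg_left hd hA0.le
        _ = x / 4 := by field_simp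
    have d1 := (abs_empRisk_sub_le hn (fun i => (hω i).1) p θ θ').trans hd'
    have d2 := (abs_risk_sub_le hm hA p θ θ').trans hd'
    have hsum : ∑ i, (f ⟨θ', hθ'⟩ (ξ i ω) - ∫ o, f ⟨θ', hθ'⟩ o ∂ν) =
        n * (σ * (empRisk (fun i => ξ i ω) p θ' - risk ν p θ')) := by
      simp only [hfint, (hω _).2, ← mul_sub, ← Finset.mul_sum, sub_sub_sub_cancel_right,
        Finset.sum_sub_distrib, Finset.sum_const, Finset.card_univ, Fintype.card_fin,
        nsmul_eq_mul, empRisk]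
      field_simp
    change (n : ℝ) * (x / 2) ≤ _
    rw [hsum]
    refine mul_le_mul_of_nonneg_left ?_ hn'.le
    have d3 : |σ * (empRisk (fun i => ξ i ω) p θ - risk ν p θ) -
        σ * (empRisk (fun i => ξ i ω) p θ' - risk ν p θ')| ≤ x / 2 := by
      rw [← mul_sub, abs_mul, hσ, one_mul]
      rw [abs_le] at d1 d2 ⊢
      constructor <;> linarith
    linarith [(abs_le.1 d3).2]
  · congr 4
    ring

end Risk

/-! ### Zero padding -/

section Padding

variable {T : ℝ} {m q : ℕ}

/-- Words of length at most `p` as words of length at most `p'`. -/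
def wordCast {d p p' : ℕ} (h : p ≤ p') (w : Word d p) : Word d p' :=
  ⟨Fin.castLE (Nat.succ_le_succ h) w.1, w.2⟩

lemma wordCast_injective {d p p' : ℕ} (h : p ≤ p') :
    Function.Injective (wordCast (d := d) h) := by
  rintro ⟨⟨k, hk⟩, I⟩ ⟨⟨l, hl⟩, I'⟩ e
  simp only [wordCast, Sigma.mk.injEq, Fin.castLE_mk, Fin.mk.injEq] at e
  obtain ⟨rfl, e⟩ := e
  simp only [heq_eq_eq] at e
  subst e
  rfl

/-- The extension of a coefficient vector by `0` on the longer words. -/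
noncomputable def padParam {p p' : ℕ} (h : p ≤ p') (θ : Param m q p) : Param m q p' :=
  Function.extend (Sum.map (wordCast h) id) θ 0

lemma padParam_apply {p p' : ℕ} (h : p ≤ p') (θ : Param m q p) (i : Word (m + 1) p ⊕ Fin q) :
    padParam h θ (Sum.map (wordCast h) id i) = θ i :=
  ((wordCast_injective h).sumMap Function.injective_id).extend_apply _ _ _

lemma padParam_apply_of_notMem {p p' : ℕ} (h : p ≤ p') (θ : Param m q p)
    (i : Word (m + 1) p' ⊕ Fin q) (hi : i ∉ Set.range (Sum.map (wordCast h) id)) :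
    padParam h θ i = 0 :=
  Function.extend_apply' _ _ _ hi

lemma score_padParam {p p' : ℕ} (h : p ≤ p') (θ : Param m q p) (o : Obs T m q) :
    score p' (padParam h θ) o.1 o.2.1 = score p θ o.1 o.2.1 := by
  rw [score_eq_sum_feature, score_eq_sum_feature]
  symm
  refine Fintype.sum_of_injective _ ((wordCast_injective h).sumMap Function.injective_id) _ _
    (fun i hi => by rw [padParam_apply_of_notMem h θ i hi, zero_mul]) fun i => ?_
  rw [padParam_apply]
  rcases i with w | j <;> rfl

/-- With preservation of the ball, this makes the minimal risk nonincreasing in the order, so every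
order below `pstar` can be compared with `pstar - 1`. -/
lemma risk_padParam (ν : Measure (Obs T m q)) {p p' : ℕ} (h : p ≤ p') (θ : Param m q p) :
    risk ν p' (padParam h θ) = risk ν p θ := by
  simp only [risk, score_padParam]

lemma padParam_mem_ball {p p' : ℕ} (h : p ≤ p') {r : ℝ} {θ : Param m q p}
    (hθ : θ ∈ ball m q p r) : padParam h θ ∈ ball m q p' r := by
  have : ∑ i, |θ i| = ∑ i, |padParam h θ i| :=
    Fintype.sum_of_injective _ ((wordCast_injective h).sumMap Function.injective_id) _ _
      (fun i hi => by rw [padParam_apply_of_notMem h θ i hi, abs_zero]) fun i => by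
        rw [padParam_apply]
  exact this.symm.le.trans hθ

end Padding

/-! ### The number of features -/

section Dimension

lemma sDim_pos (d p : ℕ) : 0 < sDim d p := by
  rw [sDim, Finset.sum_range_succ']
  simp

lemma sDim_succ (d p : ℕ) : sDim d (p + 1) = sDim d p + d ^ (p + 1) :=
  Finset.sum_range_succ _ _

lemma sDim_mono (d : ℕ) : Monotone (sDim d) :=
  monotone_nat_of_le_succ fun p => by rw [sDim_succ]; exact Nat.le_add_right _ _

lemma lt_sDim {d : ℕ} (hd : 1 ≤ d) (p : ℕ) : p < sDim d p := by
  induction p with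
  | zero => exact sDim_pos d 0
  | succ p ih =>
    rw [sDim_succ]
    have := Nat.one_le_pow (p + 1) d hd
    omega

/-- The source of `s_d(pstar + 1) ≥ 2 s_d(pstar)`, which separates the penalties above `pstar`. -/
lemma sDim_le_pow {d : ℕ} (hd : 2 ≤ d) (p : ℕ) : sDim d p ≤ d ^ (p + 1) := by
  induction p with
  | zero => simp only [sDim, zero_add, Finset.sum_range_one, pow_zero, pow_one]; omega
  | succ p ih =>
    rw [sDim_succ, pow_succ d (p + 1)]
    nlinarith [Nat.zero_le (d ^ (p + 1))]

lemma card_word_sum_fin (d p q : ℕ) : Fintype.card (Word d p ⊕ Fin q) = sDim d p + q := by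
  simp [sDim, Finset.sum_range]

end Dimension

/-! ### Numerical bounds -/

section Numerical

lemma le_rpow_of_nStar_le {d q pstar n : ℕ} {r C Cpen ρ gap : ℝ} (hρ : 0 < ρ) (hρ' : ρ < 1 / 2)
    (hn : nStar d q pstar r C Cpen ρ gap ≤ n) :
    thresholdRHS d q pstar r C Cpen gap ≤ (n : ℝ) ^ min ρ (1 / 2 - ρ) := by
  have hmin : 0 < min ρ (1 / 2 - ρ) := lt_min hρ (by linarith)
  -- Nonemptiness is essential: `sInf ∅ = 0` would make `nStar` meaningless.
  have hne : {n : ℕ | thresholdRHS d q pstar r C Cpen gap ≤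
      (n : ℝ) ^ min ρ (1 / 2 - ρ)}.Nonempty :=
    (((tendsto_rpow_atTop hmin).comp tendsto_natCast_atTop_atTop).eventually_ge_atTop _).exists
  refine (Nat.sInf_mem hne).trans (Real.rpow_le_rpow (by positivity) ?_ hmin.le)
  exact_mod_cast hn

/-- Half of the exponent pays for the prefactor, the other half yields the target rate. -/
lemma four_mul_mul_exp_neg_le {M E b : ℝ} (hM : 8 * M ≤ E) (hb : 2 * b ≤ E) :
    4 * M * Real.exp (-E) ≤ Real.exp (-b) := by
  have h1 : 4 * M ≤ Real.exp (E / 2) := by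
    have := Real.add_one_le_exp (E / 2)
    linarith
  calc 4 * M * Real.exp (-E) ≤ Real.exp (E / 2) * Real.exp (-E) :=
        mul_le_mul_of_nonneg_right h1 (Real.exp_pos _).le
    _ = Real.exp (-(E / 2)) := by rw [← Real.exp_add]; ring_nf
    _ ≤ Real.exp (-b) := Real.exp_le_exp.2 (by linarith)

/-- The tail bound for the orders above the optimal one. -/
lemma tail_above_le {a K D s₁ s q Q c c' E : ℝ} (ha : 0 < a) (hK : 0 < K) (hD : 0 < D)
    (hDs : D ≤ s₁) (hs : s₁ ≤ s) (hs1 : 1 ≤ s) (hq : 0 ≤ q) (hQ : 1 ≤ Q)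
    (hthr : 432 ^ 2 * a ^ 2 * (2 * s₁ + 2 * q) ≤ Q * (K * D))
    (hc : c = K * D / (256 * a * (36 * a + 1) * s₁)) (hc' : c' ≤ c)
    (hE : Q * K * s / (512 * a ^ 2) ≤ E) :
    4 * (s + q) * Real.exp (-E) ≤ Real.exp (-(c * s + c' * Q)) := by
  have hs₁ : 0 < s₁ := hD.trans_le hDs
  have hcK : c ≤ K / (9216 * a ^ 2) := by
    rw [hc, div_le_div_iff₀ (by positivity) (by positivity)]
    have : D * (9216 * a ^ 2) ≤ s₁ * (256 * a * (36 * a + 1)) :=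
      mul_le_mul hDs (by nlinarith) (by positivity) hs₁.le
    nlinarith [mul_le_mul_of_nonneg_left this hK.le]
  have hc0 : 0 ≤ c := by rw [hc]; positivity
  -- The threshold only concerns `s₁`; since `D ≤ s₁ ≤ s`, one has `(s + q) D ≤ (s₁ + q) s`, which
  -- carries it to every larger dimension.
  have hKs : 432 ^ 2 * 2 * a ^ 2 * (s + q) ≤ Q * K * s := by
    have h1 : (s + q) * D ≤ (s₁ + q) * s := by
      nlinarith [mul_le_mul_of_nonneg_left hDs (by linarith : 0 ≤ s + q),
        mul_le_mul_of_nonneg_left hs hq]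
    have h2 : 432 ^ 2 * 2 * a ^ 2 * (s + q) * D ≤ Q * K * s * D := by
      calc 432 ^ 2 * 2 * a ^ 2 * (s + q) * D = 432 ^ 2 * 2 * a ^ 2 * ((s + q) * D) := by ring
        _ ≤ 432 ^ 2 * 2 * a ^ 2 * ((s₁ + q) * s) := by gcongr
        _ = 432 ^ 2 * a ^ 2 * (2 * s₁ + 2 * q) * s := by ring
        _ ≤ Q * (K * D) * s := by gcongr
        _ = Q * K * s * D := by ring
    exact le_of_mul_le_mul_right h2 hD
  refine four_mul_mul_exp_neg_le (le_trans ?_ hE) (le_trans ?_ hE)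
  · rw [le_div_iff₀ (by positivity)]
    nlinarith [mul_nonneg (sq_nonneg a) (by linarith : 0 ≤ s + q)]
  · have h1 : c * s ≤ c * s * Q := le_mul_of_one_le_right (by positivity) hQ
    have h2 : c' * Q ≤ c * s * Q := by
      refine mul_le_mul_of_nonneg_right (hc'.trans ?_) (by linarith)
      exact le_mul_of_one_le_right hc0 hs1
    have h3 : c * s * Q ≤ K / (9216 * a ^ 2) * s * Q := by gcongr
    have h4 : Q * K * s / (512 * a ^ 2) = 18 * (K / (9216 * a ^ 2) * s * Q) := by
      field_simp; norm_num
    have h5 : 0 ≤ K / (9216 * a ^ 2) * s * Q := by positivity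
    linarith

/-- The tail bound for the orders below the optimal one. -/
lemma tail_below_le {a G M n Q c : ℝ} (ha : 0 < a) (hM : 0 ≤ M) (hQ0 : 0 ≤ Q) (hQ : Q ≤ n)
    (hthr : 432 * a * (2 * Real.sqrt M) ≤ Real.sqrt n * G)
    (hG : 0 < G) (hc : c ≤ G ^ 2 / (1024 * a * (36 * a + 1))) :
    4 * M * Real.exp (-(n * (G / 4) ^ 2 / (8 * a ^ 2))) ≤ Real.exp (-(c * Q)) := by
  have hn : 0 ≤ n := hQ0.trans hQ
  have hsq : 432 ^ 2 * a ^ 2 * (4 * M) ≤ n * G ^ 2 := by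
    have := pow_le_pow_left₀ (by positivity) hthr 2
    calc 432 ^ 2 * a ^ 2 * (4 * M) = (432 * a * (2 * Real.sqrt M)) ^ 2 := by
          rw [mul_pow, mul_pow, mul_pow, Real.sq_sqrt hM]; ring
      _ ≤ _ := this
      _ = n * G ^ 2 := by rw [mul_pow, Real.sq_sqrt hn]
  have hE : n * (G / 4) ^ 2 / (8 * a ^ 2) = n * G ^ 2 / (128 * a ^ 2) := by
    field_simp; ring
  rw [hE]
  refine four_mul_mul_exp_neg_le ?_ ?_
  · rw [le_div_iff₀ (by positivity)]
    nlinarith [mul_nonneg (sq_nonneg a) hM]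
  · have h1 : G ^ 2 / (1024 * a * (36 * a + 1)) ≤ G ^ 2 / (256 * a ^ 2) :=
      div_le_div_of_nonneg_left (by positivity) (by positivity) (by nlinarith)
    calc 2 * (c * Q) ≤ 2 * (G ^ 2 / (256 * a ^ 2) * n) := by
          have := mul_le_mul_of_nonneg_right (hc.trans h1) hQ0
          have := mul_le_mul_of_nonneg_left hQ (by positivity : 0 ≤ G ^ 2 / (256 * a ^ 2))
          linarith
      _ = n * G ^ 2 / (128 * a ^ 2) := by field_simp; ring

/-- Uses `√(1/2) ≤ 3/4`, so at least a quarter of `√s` remains. -/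
lemma sq_sqrt_sub_sqrt_ge {s s' : ℝ} (h0 : 0 ≤ s') (h : 2 * s' ≤ s) :
    s / 16 ≤ (Real.sqrt s - Real.sqrt s') ^ 2 := by
  have hs : 0 ≤ s := by linarith
  have h1 : Real.sqrt s' ≤ 3 / 4 * Real.sqrt s := by
    rw [Real.sqrt_le_left (by positivity), mul_pow, Real.sq_sqrt hs]
    linarith
  have h2 : Real.sqrt s / 4 ≤ Real.sqrt s - Real.sqrt s' := by linarith
  calc s / 16 = (Real.sqrt s / 4) ^ 2 := by rw [div_pow, Real.sq_sqrt hs]; norm_num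
    _ ≤ _ := pow_le_pow_left₀ (by positivity) h2 2

end Numerical

/-! ### The selected order -/

section Selection

variable {T : ℝ} {m q n : ℕ} {A r Cpen ρ : ℝ} {ξ : Fin n → Obs T m q}

lemma pen_eq (d q n : ℕ) (Cpen ρ : ℝ) (p : ℕ) : pen d q n Cpen ρ p =
    Cpen * Real.sqrt (Real.exp q) * Real.sqrt (sDim d p) / (n : ℝ) ^ ρ := by
  rw [pen, Real.sqrt_mul (by positivity)]
  ring

lemma minEmpRisk_nonneg (hξ : ∀ i, IsBoundedObs A (ξ i)) (p : ℕ) : 0 ≤ minEmpRisk ξ r p :=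
  Real.sInf_nonneg (by rintro _ ⟨θ, -, rfl⟩; exact empRisk_nonneg hξ p θ)

lemma minEmpRisk_le (hξ : ∀ i, IsBoundedObs A (ξ i)) {p : ℕ} {θ : Param m q p}
    (hθ : θ ∈ ball m q p r) : minEmpRisk ξ r p ≤ empRisk ξ p θ :=
  csInf_le ⟨0, by rintro _ ⟨θ, -, rfl⟩; exact empRisk_nonneg hξ p θ⟩ ⟨θ, hθ, rfl⟩

/-- The penalty diverges in `p` while the empirical risk is nonnegative, so a minimizer exists and
the `sInf` defining `pHat` is attained. -/
lemma pHat_isMinimizer (hn : 0 < n) (hCpen : 0 < Cpen) (hξ : ∀ i, IsBoundedObs A (ξ i)) (p' : ℕ) :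
    minEmpRisk ξ r (pHat r Cpen ρ ξ) + pen (m + 1) q n Cpen ρ (pHat r Cpen ρ ξ) ≤
      minEmpRisk ξ r p' + pen (m + 1) q n Cpen ρ p' := by
  have hn' : (0 : ℝ) < (n : ℝ) ^ ρ := Real.rpow_pos_of_pos (by exact_mod_cast hn) _
  have hs : Filter.Tendsto (fun p => (sDim (m + 1) p : ℝ)) Filter.atTop Filter.atTop :=
    Filter.tendsto_atTop_mono (fun p => by exact_mod_cast (lt_sDim (by omega) p).le)
      tendsto_natCast_atTop_atTop
  have hpen : Filter.Tendsto (pen (m + 1) q n Cpen ρ) Filter.atTop Filter.atTop := by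
    simp only [funext (pen_eq (m + 1) q n Cpen ρ)]
    exact ((Real.tendsto_sqrt_atTop.comp hs).const_mul_atTop (by positivity)).atTop_div_const hn'
  have ht : Filter.Tendsto (fun p => minEmpRisk ξ r p + pen (m + 1) q n Cpen ρ p)
      Filter.cofinite Filter.atTop := by
    rw [Nat.cofinite_eq_atTop]
    exact Filter.tendsto_atTop_mono
      (fun p => le_add_of_nonneg_left (minEmpRisk_nonneg hξ p)) hpen
  obtain ⟨p₀, hp₀⟩ := ht.exists_forall_le
  have hne : {p | ∀ p' : ℕ, minEmpRisk ξ r p + pen (m + 1) q n Cpen ρ p ≤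
      minEmpRisk ξ r p' + pen (m + 1) q n Cpen ρ p'}.Nonempty := ⟨p₀, hp₀⟩
  exact Nat.sInf_mem hne p'

/-- If `pHat` is an order `p` at which the risk exceeds the optimal risk by at least `g`, then the
empirical risk deviates by at least `x` on one of the balls of order `p` and `pstar`. -/
lemma exists_deviation_of_pHat_eq {ν : Measure (Obs T m q)} (hn : 0 < n) (hCpen : 0 < Cpen)
    (hr : 0 ≤ r) (hξ : ∀ i, IsBoundedObs A (ξ i)) {pstar p : ℕ} {θstar : Param m q pstar}
    (hmem : θstar ∈ ball m q pstar r) {g x : ℝ}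
    (hg : ∀ θ ∈ ball m q p r, risk ν pstar θstar + g ≤ risk ν p θ)
    (hx : 2 * x ≤ g + pen (m + 1) q n Cpen ρ p - pen (m + 1) q n Cpen ρ pstar)
    (hp : pHat r Cpen ρ ξ = p) :
    (∃ θ ∈ ball m q p r, x ≤ -1 * (empRisk ξ p θ - risk ν p θ)) ∨
      ∃ θ ∈ ball m q pstar r, x ≤ 1 * (empRisk ξ pstar θ - risk ν pstar θ) := by
  by_contra! H
  have h1 : risk ν pstar θstar + g - x ≤ minEmpRisk ξ r p := by
    refine le_csInf ⟨_, 0, zero_mem_ball p hr, rfl⟩ ?_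
    rintro _ ⟨θ, hθ, rfl⟩
    have := H.1 θ hθ
    have := hg θ hθ
    linarith
  have h2 := minEmpRisk_le hξ hmem
  have h3 := H.2 θstar hmem
  have h4 := pHat_isMinimizer (r := r) (ρ := ρ) hn hCpen hξ pstar
  rw [hp] at h4
  linarith

end Selection

/-! ### Probability of selecting a given wrong order -/

/-- The gap between the optimal risk and the minimal risk at the preceding order is positive. -/
lemma gap_pos {T : ℝ} {m q : ℕ} {ν : Measure (Obs T m q)} [IsProbabilityMeasure ν] {A r : ℝ}
    (hm : ∀ p i, AEMeasurable (feature (T := T) p i) ν) (hA : ∀ᵐ o ∂ν, IsBoundedObs A o)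
    (hr : 0 ≤ r) {pstar : ℕ} {θstar : Param m q pstar}
    (hstar : IsMinimalSufficient ν r pstar θstar) (h0 : pstar ≠ 0) :
    0 < minRisk ν r (pstar - 1) - risk ν pstar θstar := by
  obtain ⟨θ, hθ, hmin⟩ := (isCompact_ball (m := m) (q := q) (pstar - 1) r).exists_sInf_image_eq
    ⟨0, zero_mem_ball _ hr⟩ (continuous_risk hm hA _).continuousOn
  rw [minRisk, hmin, sub_pos]
  refine lt_of_le_of_ne (hstar.optimal _ θ hθ) fun h => ?_
  have := hstar.minimal _ ⟨θ, hθ, h.symm⟩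
  omega

lemma le_risk_of_lt {T : ℝ} {m q : ℕ} {ν : Measure (Obs T m q)} {r : ℝ}
    {pstar : ℕ} {θstar : Param m q pstar}
    (hstar : IsMinimalSufficient ν r pstar θstar) {p : ℕ} (hp : p < pstar) {θ : Param m q p}
    (hθ : θ ∈ ball m q p r) : minRisk ν r (pstar - 1) ≤ risk ν p θ := by
  have hp' : p ≤ pstar - 1 := by omega
  rw [← risk_padParam ν hp' θ]
  refine csInf_le ⟨risk ν pstar θstar, ?_⟩ ⟨_, padParam_mem_ball hp' hθ, rfl⟩
  rintro _ ⟨θ', hθ', rfl⟩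
  exact hstar.optimal _ θ' hθ'

/-- Two one-sided deviation events, at orders `p` and `pstar`, each of probability at most `2 M`
times the exponential; `M` dominates both feature counts. Here `g` is the risk excess at order `p`:
`0` above `pstar`, the gap below. -/
lemma measure_pHat_eq_le {T : ℝ} {m q : ℕ} {ν : Measure (Obs T m q)} [IsProbabilityMeasure ν]
    {A r Cpen ρ : ℝ} (hm : ∀ p i, AEMeasurable (feature (T := T) p i) ν)
    (hA : ∀ᵐ o ∂ν, IsBoundedObs A o) (hA0 : 0 < A) (hr : 0 < r) (hCpen : 0 < Cpen)
    {n : ℕ} (hn : 0 < n) {Ω : Type*} [MeasurableSpace Ω] {μ : Measure Ω} [IsProbabilityMeasure μ]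
    {ξ : Fin n → Ω → Obs T m q} (hlaw : ∀ i, HasLaw (ξ i) ν μ) (hindep : iIndepFun ξ μ)
    {pstar p : ℕ} {θstar : Param m q pstar} (hmem : θstar ∈ ball m q pstar r) {g x M : ℝ}
    (hg : ∀ θ ∈ ball m q p r, risk ν pstar θstar + g ≤ risk ν p θ) (hx0 : 0 < x)
    (hx : 2 * x ≤ g + pen (m + 1) q n Cpen ρ p - pen (m + 1) q n Cpen ρ pstar)
    (hM : (sDim (m + 1) p : ℝ) + q ≤ M) (hM' : (sDim (m + 1) pstar : ℝ) + q ≤ M) :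
    μ {ω | pHat r Cpen ρ (fun i => ξ i ω) = p} ≤
      ENNReal.ofReal (4 * M * Real.exp (-(n * x ^ 2 / (8 * (r * (2 * A)) ^ 2)))) := by
  have hsample : ∀ᵐ ω ∂μ, ∀ i, IsBoundedObs A (ξ i ω) :=
    ae_all_iff.2 fun i => ae_of_ae_map (hlaw i).aemeasurable ((hlaw i).map_eq.symm ▸ hA)
  set e := Real.exp (-(n * x ^ 2 / (8 * (r * (2 * A)) ^ 2))) with he
  have bound : ∀ (p' : ℕ) (σ : ℝ), |σ| = 1 → (sDim (m + 1) p' : ℝ) + q ≤ M →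
      μ {ω | ∃ θ ∈ ball m q p' r, x ≤ σ * (empRisk (fun i => ξ i ω) p' θ - risk ν p' θ)} ≤
        ENNReal.ofReal (2 * M * e) := by
    intro p' σ hσ hMp
    refine (measure_exists_deviation_le hm hA hA0 hr hn hlaw hindep p' hx0 hσ).trans
      (ENNReal.ofReal_le_ofReal ?_)
    rw [card_word_sum_fin, he, show 32 * r ^ 2 * A ^ 2 = 8 * (r * (2 * A)) ^ 2 by ring]
    push_cast
    gcongr
  calc _ ≤ μ ({ω | ∃ θ ∈ ball m q p r,
            x ≤ -1 * (empRisk (fun i => ξ i ω) p θ - risk ν p θ)} ∪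
          {ω | ∃ θ ∈ ball m q pstar r,
            x ≤ 1 * (empRisk (fun i => ξ i ω) pstar θ - risk ν pstar θ)}) := by
        refine measure_mono_ae ?_
        filter_upwards [hsample] with ω hω hp
        exact exists_deviation_of_pHat_eq hn hCpen hr.le hω hmem hg hx hp
    _ ≤ ENNReal.ofReal (2 * M * e) + ENNReal.ofReal (2 * M * e) :=
        (measure_union_le _ _).trans
          (add_le_add (bound p (-1) (by simp) hM) (bound pstar 1 (by simp) hM'))
    _ = _ := by
        have : 0 ≤ M := le_trans (by positivity) hM
        rw [← ENNReal.ofReal_add (by positivity) (by positivity)]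
        congr 1
        ring

lemma summable_exp_neg_mul_sDim {d : ℕ} (hd : 1 ≤ d) {c : ℝ} (hc : 0 < c) :
    Summable fun p : ℕ => Real.exp (-(c * sDim d (p + 1))) := by
  have hgeom : Summable fun p : ℕ => Real.exp (-c) ^ p :=
    summable_geometric_of_lt_one (Real.exp_pos _).le (by rw [Real.exp_lt_one_iff]; linarith)
  refine Summable.of_nonneg_of_le (fun p => (Real.exp_pos _).le) (fun p => ?_) hgeom
  rw [← Real.exp_nat_mul]
  refine Real.exp_le_exp.2 ?_
  have h : (p : ℝ) ≤ sDim d (p + 1) := by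
    exact_mod_cast (Nat.le_succ p).trans (lt_sDim hd (p + 1)).le
  nlinarith

end PSLR

/-! ### Union over all wrong orders -/

open MeasureTheory ProbabilityTheory PSLR in
theorem theorem3
    {T : ℝ} (hT : 0 < T) {m q : ℕ} (hm : 1 ≤ m)
    -- the law of `(X, z, y)`, with `X` taking values in `ℝ^m`, so that `d = m + 1`
    (ν : Measure (Obs T m q)) [IsProbabilityMeasure ν]
    -- the semi-parametric model with bounded `F` and `γ`
    (F : BoundedContinuousFunction (FPath T m) ℝ) (γ : Fin q → ℝ)
    (hmodel : IsLogitModel ν F γ)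
    (CF Cγ : ℝ) (hCF : 0 < CF) (hCγ : 0 < Cγ)
    (hF : ‖F‖ < CF) (hγ : ∑ j, |γ j| ≤ Cγ)
    -- bounded total variation and bounded scalar covariates
    (CX Cz : ℝ) (hCX : 0 < CX) (hCz : 0 < Cz)
    (hX : ∀ᵐ o ∂ν, eVariationOn (fun t => o.1 t) Set.univ < ENNReal.ofReal CX)
    (hz : ∀ᵐ o ∂ν, ‖o.2.1‖ < Cz)
    -- the radius, the minimal sufficient order and its coefficients
    (r : ℝ) (hr : 0 < r) (pstar : ℕ) (θstar : Param m q pstar)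
    (hstar : IsMinimalSufficient ν r pstar θstar)
    -- the semi-parametric risk bounds all truncated risks from below
    (hA4 : ∀ p (θ : Param m q p), semiparamRisk ν CF Cγ ≤ risk ν p θ)
    -- the penalty
    (Cpen ρ : ℝ) (hCpen : 0 < Cpen) (hρ : 0 < ρ) (hρ' : ρ < 1 / 2)
    (C gap : ℝ) (hC : C = lipC CX Cz T)
    (hgap : gap = minRisk ν r (pstar - 1) - risk ν pstar θstar)
    -- an i.i.d. sample of size `n`
    (n : ℕ) (hn : nStar (m + 1) q pstar r C Cpen ρ gap ≤ n)
    {Ω : Type*} [MeasurableSpace Ω] (μ : Measure Ω) [IsProbabilityMeasure μ]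
    (ξ : Fin n → Ω → Obs T m q)
    (hlaw : ∀ i, HasLaw (ξ i) ν μ) (hindep : iIndepFun ξ μ) :
    μ.real {ω | pHat r Cpen ρ (fun i => ξ i ω) ≠ pstar} ≤
      c1 (m + 1) q pstar r C Cpen *
        Real.exp (-(c2 (m + 1) q pstar r C Cpen gap * (n : ℝ) ^ (1 - 2 * ρ))) := by
  obtain ⟨A, hAdef⟩ : ∃ A, A = Cz + Real.exp (CX + T) := ⟨_, rfl⟩
  have hA0 : 0 < A := by rw [hAdef]; positivity
  have hCA : C = 2 * A := by rw [hC, lipC, hAdef]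
  have hC0 : 0 < C := by rw [hCA]; positivity
  have hA : ∀ᵐ o ∂ν, IsBoundedObs A o := hAdef ▸ ae_isBoundedObs hT hCX hmodel.1 hX hz
  have hmeas := aemeasurable_feature (m := m) (q := q) hT hCX hX
  have hgap0 : pstar ≠ 0 → 0 < gap := fun h => hgap ▸ gap_pos hmeas hA hr.le hstar h
  -- abbreviations
  obtain ⟨a, ha⟩ : ∃ a, a = r * C := ⟨_, rfl⟩
  have ha0 : 0 < a := by rw [ha]; positivity
  obtain ⟨κ, hκ⟩ : ∃ κ, κ = Cpen * Real.sqrt (Real.exp q) := ⟨_, rfl⟩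
  have hκ0 : 0 < κ := by rw [hκ]; positivity
  have hκ2 : κ ^ 2 = Cpen ^ 2 * Real.exp q := by
    rw [hκ, mul_pow, Real.sq_sqrt (Real.exp_pos _).le]
  obtain ⟨s, hs⟩ : ∃ s : ℕ → ℝ, ∀ p, s p = sDim (m + 1) p := ⟨_, fun _ => rfl⟩
  have hs1 : ∀ p, 1 ≤ s p := fun p => by rw [hs]; exact_mod_cast sDim_pos _ _
  have hsm : Monotone s := fun i j h => by rw [hs, hs]; exact_mod_cast sDim_mono _ h
  obtain ⟨D, hD⟩ : ∃ D : ℝ, D = ((m + 1 : ℕ) : ℝ) ^ (pstar + 1) := ⟨_, rfl⟩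
  have hD0 : 0 < D := by rw [hD]; positivity
  have hsD : s (pstar + 1) = s pstar + D := by
    rw [hs, hs, hD, sDim_succ]; push_cast; ring
  have hsD' : s pstar ≤ D := by
    rw [hs, hD]; exact_mod_cast sDim_le_pow (by omega) pstar
  have hq0 : (0 : ℝ) ≤ q := by positivity
  -- consequences of the threshold
  obtain ⟨W, hW⟩ : ∃ W, W = (n : ℝ) ^ min ρ (1 / 2 - ρ) := ⟨_, rfl⟩
  have hthr := le_rpow_of_nStar_le hρ hρ' hn
  rw [thresholdRHS, ← hW, ← hs, ← hD, ← hκ] at hthr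
  have hpi : 1 ≤ Real.sqrt Real.pi := by
    rw [Real.one_le_sqrt]; linarith [Real.pi_gt_three]
  -- The two summands of the threshold coefficient are used separately, and `√π` only through `1 ≤
  -- √π`.
  have hcoef : 432 * a ≤ 432 * Real.sqrt Real.pi * r * C + κ ∧
      κ ≤ 432 * Real.sqrt Real.pi * r * C + κ := by
    have : 432 * Real.sqrt Real.pi * r * C = 432 * a * Real.sqrt Real.pi := by rw [ha]; ring
    rw [this]
    constructor <;> nlinarith
  obtain ⟨B, hB⟩ : ∃ B, B = 432 * Real.sqrt Real.pi * r * C + κ := ⟨_, rfl⟩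
  rw [← hB] at hthr hcoef
  have hB0 : 0 < B := by linarith [hcoef.2]
  have hKD : Cpen * Real.sqrt (Real.exp q * D) = κ * Real.sqrt D := by
    rw [hκ, Real.sqrt_mul (Real.exp_pos _).le]; ring
  rw [hKD] at hthr
  have hfirst : 0 ≤ if pstar = 0 then (0 : ℝ) else 2 * Real.sqrt (s (pstar + 1) + q) / gap := by
    split_ifs with h
    · exact le_rfl
    · have := hgap0 h
      positivity
  have hthr₁ : 432 * a * Real.sqrt (2 * s (pstar + 1) + 2 * q) ≤ W * (κ * Real.sqrt D) := by
    rw [← div_le_iff₀ (by positivity), mul_div_assoc]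
    refine le_trans ?_ hthr
    exact mul_le_mul hcoef.1 (le_add_of_nonneg_left hfirst) (by positivity) hB0.le
  have hthr₂ : pstar ≠ 0 → 432 * a * (2 * Real.sqrt (s (pstar + 1) + q)) ≤ W * gap ∧
      κ * (2 * Real.sqrt (s (pstar + 1) + q)) ≤ W * gap := by
    intro h
    have hg := hgap0 h
    rw [if_neg h] at hthr
    have h1 : B * (2 * Real.sqrt (s (pstar + 1) + q) / gap) ≤ W := by
      refine le_trans (mul_le_mul_of_nonneg_left ?_ hB0.le) hthr
      exact le_add_of_nonneg_right (by positivity)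
    rw [← mul_div_assoc, div_le_iff₀ hg] at h1
    exact ⟨le_trans (mul_le_mul_of_nonneg_right hcoef.1 (by positivity)) h1,
      le_trans (mul_le_mul_of_nonneg_right hcoef.2 (by positivity)) h1⟩
  have hs₁pos : 0 < s (pstar + 1) := by linarith [hs1 (pstar + 1)]
  have hWpos : 0 < W := by
    have : 0 < 432 * a * Real.sqrt (2 * s (pstar + 1) + 2 * q) := by positivity
    by_contra hneg
    have := mul_nonpos_of_nonpos_of_nonneg (not_lt.1 hneg)
      (by positivity : 0 ≤ κ * Real.sqrt D)
    linarith
  have hn0 : 0 < n := by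
    rcases Nat.eq_zero_or_pos n with h | h
    · rw [hW, h, Nat.cast_zero, Real.zero_rpow (lt_min hρ (by linarith)).ne'] at hWpos
      exact absurd hWpos (lt_irrefl _)
    · exact h
  have hn1 : (1 : ℝ) ≤ n := by exact_mod_cast hn0
  have hnpos : (0 : ℝ) < n := by linarith
  obtain ⟨Q, hQ⟩ : ∃ Q, Q = (n : ℝ) ^ (1 - 2 * ρ) := ⟨_, rfl⟩
  have hQ1 : 1 ≤ Q := by rw [hQ]; exact Real.one_le_rpow hn1 (by linarith)
  have hQn : Q ≤ n := by
    rw [hQ]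
    exact (Real.rpow_le_rpow_of_exponent_le hn1 (by linarith)).trans_eq (Real.rpow_one _)
  have hW2 : W ^ 2 ≤ Q := by
    rw [hW, hQ, ← Real.rpow_natCast, ← Real.rpow_mul hnpos.le]
    refine Real.rpow_le_rpow_of_exponent_le hn1 ?_
    have := min_le_right ρ (1 / 2 - ρ)
    push_cast
    linarith
  have hWρ : W ≤ (n : ℝ) ^ ρ := by
    rw [hW]; exact Real.rpow_le_rpow_of_exponent_le hn1 (min_le_left _ _)
  have hWsqrt : W ≤ Real.sqrt n := Real.le_sqrt_of_sq_le (hW2.trans hQn)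
  have hnρ : 0 < (n : ℝ) ^ ρ := Real.rpow_pos_of_pos hnpos _
  have hpen : ∀ p, pen (m + 1) q n Cpen ρ p = κ * Real.sqrt (s p) / (n : ℝ) ^ ρ := fun p => by
    rw [pen_eq, hκ, hs]
  -- the constants
  obtain ⟨c₀, hc₀⟩ : ∃ c₀, c₀ = c0 (m + 1) q pstar r C Cpen := ⟨_, rfl⟩
  obtain ⟨c₂, hc₂⟩ : ∃ c₂, c₂ = c2 (m + 1) q pstar r C Cpen gap := ⟨_, rfl⟩
  have hc₀eq : c₀ = κ ^ 2 * D / (256 * a * (36 * a + 1) * s (pstar + 1)) := by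
    rw [hc₀, c0, hκ2, hD, ha, hs]; ring_nf
  have hc₀pos : 0 < c₀ := by rw [hc₀eq]; positivity
  have hc₀eq' : 1 / (256 * r * C * (36 * r * C + 1)) * (Cpen ^ 2 * ((m + 1 : ℕ) : ℝ) ^ (pstar + 1) *
      Real.exp q / sDim (m + 1) (pstar + 1)) = c₀ := by
    rw [hc₀, c0, div_mul_div_comm, one_mul]
  have hc₂c₀ : c₂ ≤ c₀ := by
    rw [hc₂, c2, ← hc₀eq']
    refine mul_le_mul_of_nonneg_left ?_ (by positivity)
    split_ifs
    · exact le_rfl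
    · exact min_le_left _ _
  have hc₂gap : pstar ≠ 0 → c₂ ≤ gap ^ 2 / (1024 * a * (36 * a + 1)) := by
    intro h
    rw [hc₂, c2, if_neg h]
    refine (mul_le_mul_of_nonneg_left (min_le_right _ _) (by positivity)).trans_eq ?_
    rw [ha, div_mul_div_comm, one_mul]
    congr 1
    ring
  obtain ⟨e, he⟩ : ∃ e, e = Real.exp (-(c₂ * Q)) := ⟨_, rfl⟩
  have he0 : 0 < e := by rw [he]; exact Real.exp_pos _
  rw [← hQ, ← hc₂, ← he, c1, ← hc₀]
  -- orders above `pstar`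
  have habove : ∀ j : ℕ, μ {ω | pHat r Cpen ρ (fun i => ξ i ω) = pstar + 1 + j} ≤
      ENNReal.ofReal (Real.exp (-(c₀ * sDim (m + 1) (j + 1))) * e) := by
    intro j
    have hsp : s (pstar + 1) ≤ s (pstar + 1 + j) := hsm (Nat.le_add_right _ _)
    have hspos : 0 < s pstar := by linarith [hs1 pstar]
    have hlt : Real.sqrt (s pstar) < Real.sqrt (s (pstar + 1 + j)) :=
      Real.sqrt_lt_sqrt hspos.le (by linarith)
    -- No risk gap is available above `pstar`, so `x` is half the penalty difference.
    refine (measure_pHat_eq_le (ρ := ρ) hmeas hA hA0 hr hCpen hn0 hlaw hindep hstar.mem (g := 0)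
      (x := κ * (Real.sqrt (s (pstar + 1 + j)) - Real.sqrt (s pstar)) / (n : ℝ) ^ ρ / 2)
      (M := s (pstar + 1 + j) + q) (fun θ hθ => by
        rw [add_zero]; exact hstar.optimal _ θ hθ) ?_ ?_ ?_ ?_).trans
      (ENNReal.ofReal_le_ofReal ?_)
    · have := sub_pos.2 hlt
      positivity
    · rw [hpen, hpen]
      apply le_of_eq
      ring
    · rw [hs]
    · rw [← hs]; linarith
    · have hexp : Q * κ ^ 2 * s (pstar + 1 + j) / (512 * a ^ 2) ≤
          n * (κ * (Real.sqrt (s (pstar + 1 + j)) - Real.sqrt (s pstar)) / (n : ℝ) ^ ρ / 2) ^ 2 /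
            (8 * (r * (2 * A)) ^ 2) := by
        -- Dividing by `(n^ρ)²` turns `n` into `Q = n^(1-2ρ)`, the rate in the claim.
        have hnQ : (n : ℝ) = Q * ((n : ℝ) ^ ρ) ^ 2 := by
          rw [hQ, ← Real.rpow_natCast, ← Real.rpow_mul hnpos.le, ← Real.rpow_add hnpos]
          push_cast
          rw [show 1 - 2 * ρ + ρ * 2 = 1 by ring, Real.rpow_one]
        rw [← hCA, ← ha]
        have h1 := sq_sqrt_sub_sqrt_ge hspos.le
          (by linarith : 2 * s pstar ≤ s (pstar + 1 + j))
        have h2 : n * (κ * (Real.sqrt (s (pstar + 1 + j)) - Real.sqrt (s pstar)) /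
            (n : ℝ) ^ ρ / 2) ^ 2 =
            Q * κ ^ 2 * (Real.sqrt (s (pstar + 1 + j)) - Real.sqrt (s pstar)) ^ 2 / 4 := by
          nth_rewrite 1 [hnQ]
          field_simp
          norm_num
        rw [h2, div_le_div_iff₀ (by positivity) (by positivity)]
        have h3 := mul_le_mul_of_nonneg_left h1 (by positivity : 0 ≤ Q * κ ^ 2 * a ^ 2)
        linarith
      have hthrsq : 432 ^ 2 * a ^ 2 * (2 * s (pstar + 1) + 2 * q) ≤ Q * (κ ^ 2 * D) := by
        have h1 := pow_le_pow_left₀ (by positivity) hthr₁ 2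
        rw [mul_pow, mul_pow, Real.sq_sqrt (by positivity), mul_pow, mul_pow,
          Real.sq_sqrt hD0.le] at h1
        exact h1.trans (mul_le_mul_of_nonneg_right hW2 (by positivity))
      refine (tail_above_le ha0 (pow_pos hκ0 2) hD0 (by linarith) hsp (hs1 _) hq0 hQ1 hthrsq hc₀eq
        hc₂c₀ hexp).trans ?_
      rw [he, ← Real.exp_add]
      refine Real.exp_le_exp.2 ?_
      -- Lowering the index from `pstar + 1 + j` to `j + 1` matches the series in `c1`.
      have : (sDim (m + 1) (j + 1) : ℝ) ≤ s (pstar + 1 + j) := by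
        rw [← hs]; exact hsm (by omega)
      have := mul_le_mul_of_nonneg_left this hc₀pos.le
      linarith
  -- orders below `pstar`
  have hbelow : ∀ p ∈ Finset.range pstar, μ {ω | pHat r Cpen ρ (fun i => ξ i ω) = p} ≤
      ENNReal.ofReal e := by
    intro p hp
    rw [Finset.mem_range] at hp
    have h0 : pstar ≠ 0 := by omega
    have hg := hgap0 h0
    -- The penalty at `pstar` uses at most half of the gap; the other half is split between the two
    -- deviations, hence `x = gap / 4`.
    have hpens : pen (m + 1) q n Cpen ρ pstar ≤ gap / 2 := by
      rw [hpen, div_le_iff₀ hnρ]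
      have h1 : Real.sqrt (s pstar) ≤ Real.sqrt (s (pstar + 1) + q) :=
        Real.sqrt_le_sqrt (by linarith)
      have h2 := mul_le_mul_of_nonneg_left h1 hκ0.le
      have h3 := mul_le_mul_of_nonneg_right hWρ hg.le
      linarith [(hthr₂ h0).2]
    have hpen0 : 0 ≤ pen (m + 1) q n Cpen ρ p := by rw [hpen]; positivity
    refine (measure_pHat_eq_le (ρ := ρ) hmeas hA hA0 hr hCpen hn0 hlaw hindep hstar.mem (g := gap)
      (x := gap / 4) (M := s (pstar + 1) + q) (fun θ hθ => ?_) (by positivity) (by linarith)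
      ?_ ?_).trans (ENNReal.ofReal_le_ofReal ?_)
    · have := le_risk_of_lt hstar hp hθ
      rw [hgap]
      linarith
    · rw [← hs]
      linarith [hsm (by omega : p ≤ pstar + 1)]
    · rw [← hs]
      linarith
    · rw [← hCA, ← ha, he]
      refine tail_below_le ha0 (by positivity) (by linarith) hQn ?_ hg (hc₂gap h0)
      exact (hthr₂ h0).1.trans (mul_le_mul_of_nonneg_right hWsqrt hg.le)
  -- the union bound
  have hsum := summable_exp_neg_mul_sDim (d := m + 1) (by omega) hc₀pos
  have hsub : {ω | pHat r Cpen ρ (fun i => ξ i ω) ≠ pstar} ⊆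
      (⋃ p ∈ Finset.range pstar, {ω | pHat r Cpen ρ (fun i => ξ i ω) = p}) ∪
        ⋃ j : ℕ, {ω | pHat r Cpen ρ (fun i => ξ i ω) = pstar + 1 + j} := by
    intro ω hω
    rcases lt_or_gt_of_ne hω with h | h
    · exact Or.inl (Set.mem_iUnion₂.2 ⟨_, Finset.mem_range.2 h, rfl⟩)
    · refine Or.inr (Set.mem_iUnion.2 ⟨pHat r Cpen ρ (fun i => ξ i ω) - (pstar + 1), ?_⟩)
      change _ = _
      omega
  have hnonneg : 0 ≤ ∑' j : ℕ, Real.exp (-(c₀ * sDim (m + 1) (j + 1))) :=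
    tsum_nonneg fun j => (Real.exp_pos _).le
  have hmain : μ {ω | pHat r Cpen ρ (fun i => ξ i ω) ≠ pstar} ≤
      ENNReal.ofReal (pstar * e + (∑' j : ℕ, Real.exp (-(c₀ * sDim (m + 1) (j + 1)))) * e) := by
    rw [ENNReal.ofReal_add (by positivity) (by positivity), ← tsum_mul_right,
      ENNReal.ofReal_tsum_of_nonneg (fun j => by positivity) (hsum.mul_right e)]
    refine (measure_mono hsub).trans ((measure_union_le _ _).trans (add_le_add ?_ ?_))
    · refine (measure_biUnion_finset_le _ _).trans ((Finset.sum_le_sum hbelow).trans_eq ?_)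
      rw [Finset.sum_const, Finset.card_range, nsmul_eq_mul, ENNReal.ofReal_mul (by positivity),
        ENNReal.ofReal_natCast]
    · exact (measure_iUnion_le _).trans (ENNReal.tsum_le_tsum habove)
  refine (ENNReal.toReal_le_of_le_ofReal (by positivity) hmain).trans ?_
  rw [← add_mul]
  refine mul_le_mul_of_nonneg_right ?_ he0.le
  have : (0 : ℝ) ≤ pstar := by positivity
  -- The union bound gives `pstar + ∑'`, which the factors `148` and `74` in `c1` dominate.
  linarith
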